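/- Write $[X]=\{1,2,\dots,\lfloor X\rfloor\}$ for real $X\ge 1$. Let $s,t\ge 1$, let $a_1,\dots,a_s,b_1,\dots,b_t$ be non-zero integers, and let $r\ge 1$. Consider the equation $$a_1x_1+\dots+a_sx_s=b_1y_1^2+\dots+b_ty_t^2. \qquad (*)$$ (1) There exist a constant $c>0$ and a function $\varepsilon:\mathbb N\to\mathbb R$ with $\varepsilon(N)\to 0$ as $N\to\infty$, both depending only on $r$ and the coefficients $a_i,b_j$, such that the following holds. If $\emptyset\ne I\subseteq\{1,\dots,s\}$ satisfies $\sum_{i\in I}a_i=0$, then for every positive integer $N$ and all sets with $C_1\cup\dots\cup C_r=[N]$ there is a class $C_k$ such that the number of solutions of $(*)$ with $x_1,\dots,x_s,y_1,\dots,y_t\in C_k$ is at least $$c\,N^{(|I|+s+t-2)/2^r}\,(1-\varepsilon(N)).$$ (2) There exist constants $c>0$ and $K$, depending only on $r$ and the coefficients $a_i,b_j$, such that the following holds. If $\emptyset\ne S\subseteq\{1,\dots,s\}$ satisfies $\sum_{i\in S}a_i=0$, then for every positive integer $N>K$ and all sets with $C_1\cup\dots\cup C_r=[N]$ there exist an integer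 $n$ with $1\le n\le r$, a class $C_k$ and an interval $J=(u,u+N^{1/2^{n-1}}]$ of length $N^{1/2^{n-1}}$, with $u$ a non-negative integer, such that, with $M:=N^{1/2^n}$, the number of solutions of $(*)$ with $$x_i\in C_k\cap J\ (i\in S),\qquad x_i\in C_k\cap[M]\ (i\notin S),\qquad y_1,\dots,y_t\in C_k\cap[M]$$ is at least $c\,M^{|S|+s+t-2}$. -/

import Mathlib

open Filter Topology

/-- The set `[X] = {1, 2, …, ⌊X⌋}` for a real number `X`. -/
noncomputable def initialInterval (X : ℝ) : Finset ℕ := Finset.Icc 1 ⌊X⌋₊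

/-- `C 0 ∪ ⋯ ∪ C (r - 1) = [N]`.  (The classes are allowed to overlap; in particular this covers
every partition of `[N]` into `r` parts.) -/
def IsColouring {r : ℕ} (N : ℕ) (C : Fin r → Finset ℕ) : Prop :=
  Finset.univ.biUnion C = Finset.Icc 1 N

/-- The part of the finite set `A` in the half-open real interval `(u, u + L]` of length `L`. -/
noncomputable def restrictToInterval (A : Finset ℕ) (u : ℕ) (L : ℝ) : Finset ℕ :=
  A.filter fun x => (x : ℝ) ∈ Set.Ioc (u : ℝ) ((u : ℝ) + L)

/-- The number of solutions of `a₁x₁ + ⋯ + aₛxₛ = b₁y₁² + ⋯ + bₜyₜ²` with every `xᵢ ∈ X i`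
and every `yⱼ ∈ Y j`. -/
def solutionCount {s t : ℕ} (a : Fin s → ℤ) (b : Fin t → ℤ)
    (X : Fin s → Finset ℕ) (Y : Fin t → Finset ℕ) : ℕ :=
  ((Fintype.piFinset X ×ˢ Fintype.piFinset Y).filter fun p =>
    ∑ i, a i * (p.1 i : ℤ) = ∑ j, b j * (p.2 j : ℤ) ^ 2).card

/-! The proof follows the colour classes down the scales N, N^(1/2), N^(1/4), …. Suppose n + 1
classes are each dense in some interval of length M² = N^(1/2^n). One finds a dense set B ⊆ [M] such
that every D ⊆ B with |D| ≥ |B|/r yields the expected number of solutions when the x_i with i ∈ S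
range over any one of these classes in its interval and all other variables range over D. Some class
occupies a share 1/r of B. If it is one of the n + 1, the solutions are monochromatic. Otherwise it
is a further class dense at scale M, while the old ones stay dense on subintervals of length M. As
there are only r classes, the first case occurs at some scale n ≤ r
(`exists_localised_or_dense_colours`).

The set B comes from Fourier analysis on ZMod Q with Q a prime of order M²
(`exists_common_bohr_set`). The coefficients on S sum to zero, so the position of the interval is
irrelevant. The count is the average over frequencies of f·w, where f is the product of the
transforms of the dense set A and w is the product of the exponential sums over D. Frequencies are
split by the size of one transform of A.

Large: B is a Bohr set on which the linear and quadratic phases of these frequencies are nearly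
trivial, so w is nearly constant, and the sum of f is large because dense sets contain a positive
proportion of the solutions of a translation-invariant linear equation (`exists_le_linearCount`). B
is dense by a recurrence deduced from Roth's theorem. Small: Hölder's inequality and the sharp sixth
moment of the quadratic exponential sum, O(X⁴) solutions without logarithmic loss
(`card_sum_three_sq_eq_le`). Intermediate: the lower threshold must be chosen after the density of
B, hence after the upper one; pigeonholing over boundedly many successive thresholds finds a gap of
small energy. -/

/-! ### Recurrence and the density of quadratic Bohr sets -/

open Finset in
/-- Uniform simultaneous recurrence of linear and quadratic phases. -/
theorem exists_uniform_recurrence (d : ℕ) {ρ : ℝ} (hρ : 0 < ρ) :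
    ∃ W : ℕ, 0 < W ∧ ∀ (ι : Type) [Fintype ι], Fintype.card ι ≤ d → ∀ α γ : ι → ℂ,
      (∀ i, ‖α i‖ = 1) → (∀ i, ‖γ i‖ = 1) →
      ∃ z : ℕ, 1 ≤ z ∧ z ≤ W ∧ ∀ i, ‖α i ^ z - 1‖ ≤ ρ ∧ ‖γ i ^ z ^ 2 - 1‖ ≤ ρ := by
  classical
  obtain ⟨T, hTf, hT⟩ := Metric.totallyBounded_iff.1
    (isCompact_sphere (0 : ℂ) 1).totallyBounded (ρ / 4) (by positivity)
  have hcell : ∀ z : ℂ, ‖z‖ = 1 → ∃ t : T, dist z t < ρ / 4 := by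
    intro z hz
    have := hT (show z ∈ Metric.sphere (0 : ℂ) 1 by simpa using hz)
    simpa using this
  have : Fintype T := hTf.fintype
  have hTne : 0 < Fintype.card T := by
    obtain ⟨t, -⟩ := hcell 1 (by simp)
    exact Fintype.card_pos_iff.2 ⟨t⟩
  set G := Fintype.card T with hG
  set K : ℕ := G ^ d * G ^ d with hK
  have hKpos : 0 < K := by positivity
  -- Roth's bound at density 1/K, so that the most popular cell contains a three-term progression.
  -- It depends only on d and ρ.
  set W := max 1 (cornersTheoremBound ((1 / (K : ℝ)) / 3)) with hW
  refine ⟨W, by positivity, fun ι _ hι α γ hα hγ => ?_⟩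
  -- The second difference of n² with step z is 2z². With square roots γ' of γ, the second
  -- difference of the phase γ' ^ n² along a progression is therefore exactly γ ^ z².
  choose γ' hγ' using fun i => IsAlgClosed.exists_pow_nat_eq (γ i) two_pos
  have hγ'1 : ∀ i, ‖γ' i‖ = 1 := fun i => by
    have h := hγ i
    rw [← hγ' i, norm_pow] at h
    exact (pow_eq_one_iff_of_nonneg (norm_nonneg _) two_ne_zero).1 h
  choose κ hκ using fun z : {z : ℂ // ‖z‖ = 1} => hcell z.1 z.2
  let col : ℕ → (ι → T) × (ι → T) := fun n =>
    (fun i => κ ⟨α i ^ n, by simp [hα]⟩, fun i => κ ⟨γ' i ^ n ^ 2, by simp [hγ'1]⟩)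
  have hcard : Fintype.card ((ι → T) × (ι → T)) ≤ K := by
    simp only [Fintype.card_prod, Fintype.card_fun]
    exact Nat.mul_le_mul (Nat.pow_le_pow_right hTne hι) (Nat.pow_le_pow_right hTne hι)
  obtain ⟨c, -, hc⟩ : ∃ c ∈ (univ : Finset ((ι → T) × (ι → T))),
      (W : ℝ) / K ≤ #{n ∈ range W | col n = c} := by
    by_contra! h
    have h0 : (univ : Finset ((ι → T) × (ι → T))).Nonempty := ⟨col 0, mem_univ _⟩
    have h1 : (W : ℝ) = ∑ c : (ι → T) × (ι → T), (#{n ∈ range W | col n = c} : ℝ) := by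
      rw [← Nat.cast_sum, ← card_eq_sum_card_fiberwise (fun x _ => mem_coe.2 (mem_univ _))]
      simp
    have h2 := sum_lt_sum_of_nonempty h0 h
    rw [← h1, sum_const, nsmul_eq_mul, card_univ] at h2
    have h3 : (Fintype.card ((ι → T) × (ι → T)) : ℝ) * (W / K) ≤ K * (W / K) := by gcongr
    rw [mul_div_cancel₀ _ (by positivity)] at h3
    linarith
  have hR := roth_3ap_theorem_nat (n := W) (1 / (K : ℝ)) (by positivity) (le_max_right _ _)
    {n ∈ range W | col n = c} (filter_subset _ _) (by rw [one_div_mul_eq_div]; exact hc)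
  have key : ∀ a z : ℕ, 1 ≤ z → a + 2 * z < W → col a = c → col (a + z) = c →
      col (a + 2 * z) = c → ∀ i, ‖α i ^ z - 1‖ ≤ ρ ∧ ‖γ i ^ z ^ 2 - 1‖ ≤ ρ := by
    intro a z hz _ h0 h1 h2 i
    have e01 := h0.trans h1.symm
    have e12 := h1.trans h2.symm
    have hclose : ∀ u v : {z : ℂ // ‖z‖ = 1}, κ u = κ v → ‖u.1 - v.1‖ ≤ ρ / 2 := by
      intro u v huv
      have h1 := hκ u
      have h2 := hκ v
      rw [huv] at h1
      rw [← dist_eq_norm]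
      linarith [dist_triangle_right u.1 v.1 (κ v)]
    have a1 := hclose _ _ (congrFun (congrArg Prod.fst e01) i)
    have g1 := hclose _ _ (congrFun (congrArg Prod.snd e01) i)
    have g2 := hclose _ _ (congrFun (congrArg Prod.snd e12) i)
    simp only at a1 g1 g2
    constructor
    · have : α i ^ a - α i ^ (a + z) = -(α i ^ a * (α i ^ z - 1)) := by ring
      rw [this, norm_neg, norm_mul, norm_pow, hα, one_pow, one_mul] at a1
      linarith
    · set P := γ' i ^ a ^ 2
      set R := γ' i ^ (a + z) ^ 2
      set V := γ' i ^ (a + 2 * z) ^ 2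
      have hP : ‖P‖ = 1 := by simp [P, hγ'1]
      have hRn : ‖R‖ = 1 := by simp [R, hγ'1]
      have h : P * V = R ^ 2 * γ i ^ z ^ 2 := by
        simp only [P, V, R, ← hγ' i, ← pow_mul, ← pow_add]
        congr 1
        ring
      have h' : R ^ 2 * (γ i ^ z ^ 2 - 1) = (P - R) * R - P * (R - V) := by
        rw [mul_sub, ← h]; ring
      have h'' := congrArg norm h'
      rw [norm_mul, norm_pow, hRn, one_pow, one_mul] at h''
      rw [h'']
      refine (norm_sub_le _ _).trans ?_
      rw [norm_mul, norm_mul, hP, hRn]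
      linarith
  simp only [ThreeAPFree, not_forall] at hR
  obtain ⟨a, ha, b, hb, e, he, hae, hab⟩ := hR
  simp only [coe_filter, mem_range, Set.mem_ofPred_eq] at ha hb he
  rcases lt_or_gt_of_ne hab with h | h
  · obtain ⟨z, rfl⟩ := Nat.exists_eq_add_of_lt h
    have hez : e = a + 2 * (z + 1) := by omega
    subst hez
    exact ⟨z + 1, by omega, by omega, key a (z + 1) (by omega) he.1 ha.2 hb.2 he.2⟩
  · have h' : e < b := by omega
    obtain ⟨z, rfl⟩ := Nat.exists_eq_add_of_lt h'
    have hez : a = e + 2 * (z + 1) := by omega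
    subst hez
    exact ⟨z + 1, by omega, by omega, key e (z + 1) (by omega) ha.1 he.2 hb.2 ha.2⟩

/-- The `y ∈ [X]` at which all the phases `ξ y / Q` and `ξ y² / Q`, `ξ ∈ Ω`, are nearly trivial. -/
noncomputable def quadraticBohrSet (Q : ℕ) [NeZero Q] (Ω : Finset (ZMod Q)) (ρ : ℝ) (X : ℕ) :
    Finset ℕ :=
  {y ∈ Finset.Icc 1 X | ∀ ξ ∈ Ω, ‖ZMod.stdAddChar (ξ * (y : ZMod Q)) - 1‖ ≤ ρ ∧
    ‖ZMod.stdAddChar (ξ * (y : ZMod Q) ^ 2) - 1‖ ≤ ρ}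

theorem norm_stdAddChar {Q : ℕ} [NeZero Q] (x : ZMod Q) : ‖ZMod.stdAddChar x‖ = 1 := by
  exact Circle.norm_coe _

open Finset in
-- For each q ≤ X / W, recurrence applied to the phases of ξq and ξq² gives z ≤ W with qz in the
-- Bohr set. A value y = qz has at most W such representations, since z determines q.
theorem exists_le_card_quadraticBohrSet (d : ℕ) {ρ : ℝ} (hρ : 0 < ρ) :
    ∃ β : ℝ, 0 < β ∧ ∃ X₀ : ℕ, ∀ (Q : ℕ) [NeZero Q] (Ω : Finset (ZMod Q)), #Ω ≤ d →
      ∀ X : ℕ, X₀ ≤ X → β * X ≤ #(quadraticBohrSet Q Ω ρ X) := by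
  classical
  obtain ⟨W, hW, h⟩ := exists_uniform_recurrence d hρ
  refine ⟨1 / (2 * W ^ 2 : ℝ), by positivity, W, fun Q _ Ω hΩ X hX => ?_⟩
  have hz : ∀ q : ℕ, ∃ z : ℕ, 1 ≤ z ∧ z ≤ W ∧ ∀ ξ : Ω,
      ‖ZMod.stdAddChar (ξ.1 * (q : ZMod Q)) ^ z - 1‖ ≤ ρ ∧
      ‖ZMod.stdAddChar (ξ.1 * (q : ZMod Q) ^ 2) ^ z ^ 2 - 1‖ ≤ ρ := fun q =>
    h Ω (by simpa using hΩ) _ _ (fun _ => norm_stdAddChar _) (fun _ => norm_stdAddChar _)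
  choose z hz1 hzW hz using hz
  have hmap : ∀ q ∈ Icc 1 (X / W), q * z q ∈ quadraticBohrSet Q Ω ρ X := by
    intro q hq
    rw [mem_Icc] at hq
    simp only [quadraticBohrSet, mem_filter, mem_Icc]
    refine ⟨⟨Nat.mul_pos hq.1 (hz1 q), ?_⟩, fun ξ hξ => ?_⟩
    · exact (Nat.mul_le_mul hq.2 (hzW q)).trans (Nat.div_mul_le_self X W)
    · have := hz q ⟨ξ, hξ⟩
      rw [← AddChar.map_nsmul_eq_pow, ← AddChar.map_nsmul_eq_pow] at this
      convert this using 5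
      · simp; ring
      · simp; ring
  have hcount : #(Icc 1 (X / W)) ≤ W * #(quadraticBohrSet Q Ω ρ X) := by
    refine card_le_mul_card_image_of_maps_to hmap W fun y hy => ?_
    have hy1 : 1 ≤ y := by
      simp only [quadraticBohrSet, mem_filter, mem_Icc] at hy
      exact hy.1.1
    calc #{q ∈ Icc 1 (X / W) | q * z q = y} ≤ #(Icc 1 W) := by
          refine card_le_card_of_injOn z (fun q _ => by simpa using ⟨hz1 q, hzW q⟩) ?_
          intro q hq q' hq' hqq
          simp only [coe_filter, mem_Icc, Set.mem_ofPred_eq] at hq hq'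
          have := hq.2.trans hq'.2.symm
          rw [hqq] at this
          exact Nat.eq_of_mul_eq_mul_right (hz1 q') this
      _ = W := by simp
  rw [Nat.card_Icc, Nat.add_sub_cancel] at hcount
  have h1 : X < W * (X / W) + W := Nat.lt_mul_div_succ X hW |>.trans_eq (by ring)
  have h2 : 1 ≤ X / W := (Nat.one_le_div_iff hW).2 hX
  have h3 : X ≤ 2 * W ^ 2 * #(quadraticBohrSet Q Ω ρ X) := by nlinarith
  rw [one_div_mul_eq_div, div_le_iff₀' (by positivity)]
  exact_mod_cast h3

/-! ### Equal sums of three squares -/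

open Finset in
theorem card_le_of_forall_dvd_sub {X m : ℕ} (hm : 0 < m) (U : Finset ℤ)
    (hU : U ⊆ Icc (-(X : ℤ)) X) (h : ∀ u ∈ U, ∀ v ∈ U, (m : ℤ) ∣ u - v) :
    #U ≤ 2 * X / m + 1 := by
  have hm' : (0 : ℤ) < m := by exact_mod_cast hm
  have hb : ∀ u ∈ U, 0 ≤ u + X ∧ u + X ≤ 2 * X := fun u hu => by
    have := mem_Icc.1 (hU hu)
    constructor <;> linarith
  rw [← card_range (2 * X / m + 1)]
  refine card_le_card_of_injOn (fun u => ((u + X) / m).toNat) (fun u hu => ?_) ?_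
  · have := hb u hu
    simp only [coe_range, Set.mem_Iio, Nat.lt_succ_iff]
    rw [Int.toNat_le]
    push_cast
    exact Int.ediv_le_ediv hm' this.2
  · intro u hu v hv huv
    have h1 := Int.ediv_nonneg (hb u hu).1 hm'.le
    have h2 := Int.ediv_nonneg (hb v hv).1 hm'.le
    have h3 : (u + X) / (m : ℤ) = (v + X) / (m : ℤ) := by simp only at huv; omega
    have h4 : (u + X) % (m : ℤ) = (v + X) % (m : ℤ) :=
      (Int.modEq_iff_dvd.2 (by rw [add_sub_add_right_eq_sub]; exact h u hu v hv)).symm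
    have h5 := Int.mul_ediv_add_emod (u + X) m
    have h6 := Int.mul_ediv_add_emod (v + X) m
    rw [h3, h4, h6] at h5
    linarith

/-- The integer points of the box `[-X, X]³` orthogonal to `(a, b, c)`. -/
noncomputable def orthogonalBoxPoints (X a b c : ℕ) : Finset (ℤ × ℤ × ℤ) :=
  {u ∈ Finset.Icc (-(X : ℤ)) X ×ˢ Finset.Icc (-(X : ℤ)) X ×ˢ Finset.Icc (-(X : ℤ)) X |
    a * u.1 + b * u.2.1 + c * u.2.2 = 0}

open Finset in
-- Let g = gcd(a, b) and d = gcd(g, c). Orthogonality forces g/d to divide the third coordinate.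
-- Once that is fixed, the second lies in one class modulo a/g and determines the first. The two
-- counts multiply to the bound because a = d · (g/d) · (a/g), and a ≤ 2X absorbs the rounding.
theorem card_orthogonalBoxPoints_mul_le {X a b c : ℕ} (ha : 0 < a) (haX : a ≤ 2 * X) :
    #(orthogonalBoxPoints X a b c) * a ≤ 16 * X ^ 2 * ((a.gcd b).gcd c) := by
  set g := a.gcd b with hg
  set d := g.gcd c with hd
  have hgpos : 0 < g := Nat.gcd_pos_of_pos_left _ ha
  have hdpos : 0 < d := Nat.gcd_pos_of_pos_left _ hgpos
  obtain ⟨a', ha'⟩ : g ∣ a := Nat.gcd_dvd_left _ _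
  obtain ⟨b', hb'⟩ : g ∣ b := Nat.gcd_dvd_right _ _
  obtain ⟨g', hg'⟩ : d ∣ g := Nat.gcd_dvd_left _ _
  obtain ⟨c', hc'⟩ : d ∣ c := Nat.gcd_dvd_right _ _
  have ha'pos : 0 < a' := Nat.pos_of_mul_pos_left (ha' ▸ ha)
  have hg'pos : 0 < g' := Nat.pos_of_mul_pos_left (hg' ▸ hgpos)
  have cop1 : IsCoprime (a' : ℤ) b' := by
    rw [Nat.isCoprime_iff_coprime]
    refine Nat.eq_of_mul_eq_mul_left hgpos ?_
    rw [← Nat.gcd_mul_left, ← ha', ← hb', mul_one]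
  have cop2 : IsCoprime (g' : ℤ) c' := by
    rw [Nat.isCoprime_iff_coprime]
    refine Nat.eq_of_mul_eq_mul_left hdpos ?_
    rw [← Nat.gcd_mul_left, ← hg', ← hc', mul_one]
  set P := orthogonalBoxPoints X a b c with hP
  have hmem : ∀ u ∈ P, (u.1 ∈ Icc (-(X : ℤ)) X ∧ u.2.1 ∈ Icc (-(X : ℤ)) X ∧
      u.2.2 ∈ Icc (-(X : ℤ)) X) ∧ (a : ℤ) * u.1 + b * u.2.1 + c * u.2.2 = 0 := fun u hu => by
    simpa only [hP, orthogonalBoxPoints, mem_filter, mem_product] using hu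
  have hfib : ∀ w ∈ P.image (fun u => u.2.2), #{u ∈ P | u.2.2 = w} ≤ 2 * X / a' + 1 := by
    intro w _
    have hinj : Set.InjOn (fun u : ℤ × ℤ × ℤ => u.2.1) ({u ∈ P | u.2.2 = w} : Finset _) := by
      intro u hu v hv huv
      simp only [coe_filter, Set.mem_ofPred_eq] at hu hv huv
      have e1 := (hmem u hu.1).2
      have e2 := (hmem v hv.1).2
      rw [hu.2, huv] at e1
      rw [hv.2] at e2
      have : (a : ℤ) * u.1 = a * v.1 := by linarith
      have := mul_left_cancel₀ (by exact_mod_cast ha.ne') this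
      exact Prod.ext this (Prod.ext huv (hu.2.trans hv.2.symm))
    rw [← card_image_of_injOn hinj]
    refine card_le_of_forall_dvd_sub ha'pos _ (fun x hx => ?_) ?_
    · obtain ⟨u, hu, rfl⟩ := mem_image.1 hx
      exact (hmem u (mem_filter.1 hu).1).1.2.1
    · intro x hx y hy
      obtain ⟨u, hu, rfl⟩ := mem_image.1 hx
      obtain ⟨v, hv, rfl⟩ := mem_image.1 hy
      rw [mem_filter] at hu hv
      have e1 := (hmem u hu.1).2
      have e2 := (hmem v hv.1).2
      rw [hu.2] at e1
      rw [hv.2] at e2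
      refine cop1.dvd_of_dvd_mul_left ⟨v.1 - u.1, ?_⟩
      refine mul_left_cancel₀ (show (g : ℤ) ≠ 0 by exact_mod_cast hgpos.ne') ?_
      rw [ha', hb'] at e1 e2
      push_cast at e1 e2
      linear_combination e1 - e2
  have himg : #(P.image (fun u => u.2.2)) ≤ 2 * X / g' + 1 := by
    have hdvd : ∀ u ∈ P, (g' : ℤ) ∣ u.2.2 := by
      intro u hu
      have e1 := (hmem u hu).2
      refine cop2.dvd_of_dvd_mul_left ⟨-(a' * u.1 + b' * u.2.1), ?_⟩
      refine mul_left_cancel₀ (show (d : ℤ) ≠ 0 by exact_mod_cast hdpos.ne') ?_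
      rw [ha', hb', hg', hc'] at e1
      push_cast at e1
      linear_combination e1
    refine card_le_of_forall_dvd_sub hg'pos _ (fun x hx => ?_) ?_
    · obtain ⟨u, hu, rfl⟩ := mem_image.1 hx
      exact (hmem u hu).1.2.2
    · intro x hx y hy
      obtain ⟨u, hu, rfl⟩ := mem_image.1 hx
      obtain ⟨v, hv, rfl⟩ := mem_image.1 hy
      exact dvd_sub (hdvd u hu) (hdvd v hv)
  have hcard := card_le_mul_card_image P _ hfib
  have hlin : ∀ m : ℕ, m ≤ 2 * X → (2 * X / m + 1) * m ≤ 4 * X := fun m hm => by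
    have := Nat.div_mul_le_self (2 * X) m
    nlinarith
  have h1 := hlin a' ((Nat.le_of_dvd ha ⟨g, by rw [ha']; ring⟩).trans haX)
  have h2 := hlin g' ((Nat.le_of_dvd ha ⟨d * a', by rw [ha', hg']; ring⟩).trans haX)
  calc #P * a ≤ (2 * X / a' + 1) * (2 * X / g' + 1) * a :=
        Nat.mul_le_mul_right _ (hcard.trans (Nat.mul_le_mul_left _ himg))
    _ = ((2 * X / a' + 1) * a') * ((2 * X / g' + 1) * g') * d := by
        have : a = d * g' * a' := by rw [ha', hg']
        conv_lhs => rw [this]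
        ring
    _ ≤ (4 * X) * (4 * X) * d := by gcongr
    _ = 16 * X ^ 2 * d := by ring

open Finset in
-- The gcd is one of the common divisors, so it is at most their sum. Up to a there are a/d
-- multiples of d, which leaves the sum of d (a/d)² = a (a/d) over d ∣ a.
theorem sum_sum_gcd_le (a : ℕ) (ha : 0 < a) :
    ∑ b ∈ Icc 1 a, ∑ c ∈ Icc 1 a, (a.gcd b).gcd c ≤ a * ∑ e ∈ a.divisors, e := by
  have hle : ∀ b c, (a.gcd b).gcd c ≤
      ∑ d ∈ a.divisors, d * ((if d ∣ b then 1 else 0) * (if d ∣ c then 1 else 0)) := by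
    intro b c
    have hmem : (a.gcd b).gcd c ∈ a.divisors := Nat.mem_divisors.2
      ⟨(Nat.gcd_dvd_left _ _).trans (Nat.gcd_dvd_left _ _), ha.ne'⟩
    refine le_trans (le_of_eq ?_) (single_le_sum (f := fun d =>
      d * ((if d ∣ b then 1 else 0) * (if d ∣ c then 1 else 0))) (fun _ _ => Nat.zero_le _) hmem)
    simp [(Nat.gcd_dvd_left (a.gcd b) c).trans (Nat.gcd_dvd_right a b), Nat.gcd_dvd_right]
  have hmult : ∀ d, ∑ b ∈ Icc 1 a, (if d ∣ b then 1 else 0) = a / d := by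
    intro d
    rw [← card_filter]
    exact Nat.Ioc_filter_dvd_card_eq_div a d
  calc ∑ b ∈ Icc 1 a, ∑ c ∈ Icc 1 a, (a.gcd b).gcd c
      ≤ ∑ b ∈ Icc 1 a, ∑ c ∈ Icc 1 a, ∑ d ∈ a.divisors,
        d * ((if d ∣ b then 1 else 0) * (if d ∣ c then 1 else 0)) :=
        sum_le_sum fun b _ => sum_le_sum fun c _ => hle b c
    _ = ∑ d ∈ a.divisors, d * ((a / d) * (a / d)) := by
        rw [sum_congr rfl fun b _ => sum_comm, sum_comm]
        refine sum_congr rfl fun d _ => ?_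
        rw [← hmult d, sum_mul_sum, mul_sum]
        simp_rw [mul_sum]
    _ = ∑ d ∈ a.divisors, a * (a / d) := by
        refine sum_congr rfl fun d hd => ?_
        rw [← mul_assoc, Nat.mul_div_cancel' (Nat.dvd_of_mem_divisors hd)]
    _ = a * ∑ e ∈ a.divisors, e := by
        rw [← mul_sum, Nat.sum_div_divisors a (fun e => e)]

open Finset in
theorem sum_sum_divisors_le (Y : ℕ) : ∑ a ∈ Icc 1 Y, ∑ e ∈ a.divisors, e ≤ Y ^ 2 := by
  calc ∑ a ∈ Icc 1 Y, ∑ e ∈ a.divisors, e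
      ≤ ∑ a ∈ Icc 1 Y, ∑ e ∈ Icc 1 Y, (if e ∣ a then 1 else 0) * e := by
        refine sum_le_sum fun a ha => ?_
        simp only [ite_mul, one_mul, zero_mul, ← sum_filter]
        refine sum_le_sum_of_subset fun e he => ?_
        rw [mem_filter, mem_Icc]
        rw [mem_Icc] at ha
        have hd := Nat.dvd_of_mem_divisors he
        exact ⟨⟨Nat.pos_of_mem_divisors he, (Nat.le_of_dvd ha.1 hd).trans ha.2⟩, hd⟩
    _ = ∑ e ∈ Icc 1 Y, (Y / e) * e := by
        rw [sum_comm]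
        refine sum_congr rfl fun e _ => ?_
        rw [← sum_mul, ← card_filter]
        congr 1
        exact Nat.Ioc_filter_dvd_card_eq_div Y e
    _ ≤ ∑ _e ∈ Icc 1 Y, Y := sum_le_sum fun e _ => Nat.div_mul_le_self Y e
    _ = Y ^ 2 := by simp [sq]

theorem card_orthogonalBoxPoints_swap (X a b c : ℕ) :
    (orthogonalBoxPoints X a b c).card = (orthogonalBoxPoints X b a c).card := by
  refine Finset.card_bij (fun u _ => (u.2.1, u.1, u.2.2)) ?_ ?_ ?_
  · rintro ⟨x, y, z⟩ h
    simp only [orthogonalBoxPoints, Finset.mem_filter, Finset.mem_product] at h ⊢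
    exact ⟨⟨h.1.2.1, h.1.1, h.1.2.2⟩, by linarith [h.2]⟩
  · rintro ⟨x, y, z⟩ _ ⟨x', y', z'⟩ _ h
    simp only [Prod.mk.injEq] at h ⊢
    tauto
  · rintro ⟨x, y, z⟩ h
    simp only [orthogonalBoxPoints, Finset.mem_filter, Finset.mem_product] at h ⊢
    exact ⟨(y, x, z), ⟨⟨h.1.2.1, h.1.1, h.1.2.2⟩, by simp only; linarith [h.2]⟩, rfl⟩

theorem card_orthogonalBoxPoints_reverse (X a b c : ℕ) :
    (orthogonalBoxPoints X a b c).card = (orthogonalBoxPoints X c b a).card := by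
  refine Finset.card_bij (fun u _ => (u.2.2, u.2.1, u.1)) ?_ ?_ ?_
  · rintro ⟨x, y, z⟩ h
    simp only [orthogonalBoxPoints, Finset.mem_filter, Finset.mem_product] at h ⊢
    exact ⟨⟨h.1.2.2, h.1.2.1, h.1.1⟩, by linarith [h.2]⟩
  · rintro ⟨x, y, z⟩ _ ⟨x', y', z'⟩ _ h
    simp only [Prod.mk.injEq] at h ⊢
    tauto
  · rintro ⟨x, y, z⟩ h
    simp only [orthogonalBoxPoints, Finset.mem_filter, Finset.mem_product] at h ⊢
    exact ⟨(z, y, x), ⟨⟨h.1.2.2, h.1.2.1, h.1.1⟩, by simp only; linarith [h.2]⟩, rfl⟩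

open Finset in
-- By symmetry the largest of a, b, c may be taken to be a, at the cost of a factor 3. Summing the
-- pointwise bound over b, c ≤ a leaves 16X² σ(a), and σ is linear on average, so no logarithm
-- appears.
theorem sum_card_orthogonalBoxPoints_le (X : ℕ) :
    ∑ a ∈ Icc 1 (2 * X), ∑ b ∈ Icc 1 (2 * X), ∑ c ∈ Icc 1 (2 * X),
      #(orthogonalBoxPoints X a b c) ≤ 192 * X ^ 4 := by
  set Y := 2 * X
  set f : ℕ → ℕ → ℕ → ℕ := fun a b c =>
    if b ≤ a ∧ c ≤ a then #(orthogonalBoxPoints X a b c) else 0 with hf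
  have hsplit : ∀ a b c, #(orthogonalBoxPoints X a b c) ≤ f a b c + f b a c + f c b a := by
    intro a b c
    by_cases h1 : b ≤ a ∧ c ≤ a
    · simp [hf, h1]; omega
    by_cases h2 : a ≤ b ∧ c ≤ b
    · have : f b a c = #(orthogonalBoxPoints X a b c) := by
        simp [hf, h2, card_orthogonalBoxPoints_swap X a b c]
      omega
    · have h3 : b ≤ c ∧ a ≤ c := by omega
      have : f c b a = #(orthogonalBoxPoints X a b c) := by
        simp [hf, h3, card_orthogonalBoxPoints_reverse X a b c]
      omega
  have hmain : ∑ a ∈ Icc 1 Y, ∑ b ∈ Icc 1 Y, ∑ c ∈ Icc 1 Y, f a b c ≤ 64 * X ^ 4 := by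
    have hstep : ∀ a ∈ Icc 1 Y, ∑ b ∈ Icc 1 Y, ∑ c ∈ Icc 1 Y, f a b c ≤
        16 * X ^ 2 * ∑ e ∈ a.divisors, e := by
      intro a ha
      rw [mem_Icc] at ha
      have hsub : Icc 1 a ⊆ Icc 1 Y := Icc_subset_Icc_right ha.2
      have e1 : ∑ b ∈ Icc 1 Y, ∑ c ∈ Icc 1 Y, f a b c =
          ∑ b ∈ Icc 1 a, ∑ c ∈ Icc 1 a, #(orthogonalBoxPoints X a b c) := by
        symm
        refine (sum_congr rfl fun b hb => ?_).trans (sum_subset hsub fun b hb hb' => ?_)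
        · rw [mem_Icc] at hb
          refine (sum_congr rfl fun c hc => ?_).trans (sum_subset hsub fun c hc hc' => ?_)
          · rw [mem_Icc] at hc
            simp [hf, hb.2, hc.2]
          · rw [mem_Icc] at hc hc'
            have : ¬ c ≤ a := by omega
            simp [hf, this]
        · rw [mem_Icc] at hb hb'
          have : ¬ b ≤ a := by omega
          simp [hf, this]
      rw [e1]
      refine Nat.le_of_mul_le_mul_right ?_ ha.1
      rw [sum_mul]
      calc _ ≤ ∑ b ∈ Icc 1 a, ∑ c ∈ Icc 1 a, 16 * X ^ 2 * ((a.gcd b).gcd c) := by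
            refine sum_le_sum fun b _ => ?_
            rw [sum_mul]
            exact sum_le_sum fun c _ => card_orthogonalBoxPoints_mul_le ha.1 ha.2
        _ = 16 * X ^ 2 * ∑ b ∈ Icc 1 a, ∑ c ∈ Icc 1 a, (a.gcd b).gcd c := by
            simp_rw [mul_sum]
        _ ≤ 16 * X ^ 2 * (a * ∑ e ∈ a.divisors, e) := Nat.mul_le_mul_left _ (sum_sum_gcd_le a ha.1)
        _ = _ := by ring
    calc _ ≤ ∑ a ∈ Icc 1 Y, 16 * X ^ 2 * ∑ e ∈ a.divisors, e := sum_le_sum hstep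
      _ = 16 * X ^ 2 * ∑ a ∈ Icc 1 Y, ∑ e ∈ a.divisors, e := by rw [mul_sum]
      _ ≤ 16 * X ^ 2 * Y ^ 2 := Nat.mul_le_mul_left _ (sum_sum_divisors_le Y)
      _ = 64 * X ^ 4 := by simp only [Y]; ring
  have hswap : ∑ a ∈ Icc 1 Y, ∑ b ∈ Icc 1 Y, ∑ c ∈ Icc 1 Y, f b a c =
      ∑ a ∈ Icc 1 Y, ∑ b ∈ Icc 1 Y, ∑ c ∈ Icc 1 Y, f a b c := sum_comm
  have hrev : ∑ a ∈ Icc 1 Y, ∑ b ∈ Icc 1 Y, ∑ c ∈ Icc 1 Y, f c b a =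
      ∑ a ∈ Icc 1 Y, ∑ b ∈ Icc 1 Y, ∑ c ∈ Icc 1 Y, f a b c := by
    rw [sum_congr rfl fun a _ => sum_comm, sum_comm]
    exact sum_congr rfl fun a _ => sum_comm
  calc _ ≤ ∑ a ∈ Icc 1 Y, ∑ b ∈ Icc 1 Y, ∑ c ∈ Icc 1 Y, (f a b c + f b a c + f c b a) :=
        sum_le_sum fun a _ => sum_le_sum fun b _ => sum_le_sum fun c _ => hsplit a b c
    _ ≤ 192 * X ^ 4 := by
        simp only [sum_add_distrib]
        rw [hswap, hrev]
        omega

open Finset in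
/-- The number of solutions of `y₁² + y₂² + y₃² = y₄² + y₅² + y₆²` in `[X]`. -/
theorem card_sum_three_sq_eq_le (X : ℕ) (D : Finset ℕ) (hD : D ⊆ Icc 1 X) :
    #{p ∈ (D ×ˢ D ×ˢ D) ×ˢ (D ×ˢ D ×ˢ D) |
      p.1.1 ^ 2 + p.1.2.1 ^ 2 + p.1.2.2 ^ 2 = p.2.1 ^ 2 + p.2.2.1 ^ 2 + p.2.2.2 ^ 2} ≤
      192 * X ^ 4 := by
  set V := Icc 1 (2 * X)
  set U := (V ×ˢ V ×ˢ V).sigma fun v => orthogonalBoxPoints X v.1 v.2.1 v.2.2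
  have hU : #U ≤ 192 * X ^ 4 := by
    rw [card_sigma]
    simp only [sum_product]
    exact sum_card_orthogonalBoxPoints_le X
  -- Factoring y² − y'² = (y + y')(y − y') makes the vector of differences, in [−X, X]³, orthogonal
  -- to the vector of sums, in [1, 2X]³.
  refine le_trans (card_le_card_of_injOn (fun p => (⟨(p.1.1 + p.2.1, p.1.2.1 + p.2.2.1,
    p.1.2.2 + p.2.2.2), ((p.1.1 : ℤ) - p.2.1, (p.1.2.1 : ℤ) - p.2.2.1,
    (p.1.2.2 : ℤ) - p.2.2.2)⟩ : (_ : ℕ × ℕ × ℕ) × (ℤ × ℤ × ℤ))) ?_ ?_) hU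
  · rintro ⟨⟨x, y, z⟩, ⟨x', y', z'⟩⟩ hp
    simp only [coe_filter, mem_product, Set.mem_ofPred_eq] at hp
    obtain ⟨⟨⟨h1, h2, h3⟩, h4, h5, h6⟩, he⟩ := hp
    have b1 := mem_Icc.1 (hD h1)
    have b2 := mem_Icc.1 (hD h2)
    have b3 := mem_Icc.1 (hD h3)
    have b4 := mem_Icc.1 (hD h4)
    have b5 := mem_Icc.1 (hD h5)
    have b6 := mem_Icc.1 (hD h6)
    simp only [U, V, mem_coe, mem_sigma, mem_product, mem_Icc, orthogonalBoxPoints, mem_filter]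
    refine ⟨by omega, by omega, ?_⟩
    have : (x : ℤ) ^ 2 + y ^ 2 + z ^ 2 = x' ^ 2 + y' ^ 2 + z' ^ 2 := by exact_mod_cast he
    push_cast
    linear_combination this
  · rintro ⟨⟨x, y, z⟩, ⟨x', y', z'⟩⟩ _ ⟨⟨u, v, w⟩, ⟨u', v', w'⟩⟩ _ h
    simp only [Sigma.mk.injEq, Prod.mk.injEq, heq_eq_eq] at h ⊢
    omega

/-! ### Translation-invariant linear equations in dense sets -/

open Finset SimpleGraph TripartiteFromTriangles in
-- The Ruzsa–Szemerédi argument. On three copies of ZMod Q take the triangles (x, x + αv, x − γv)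
-- with v ∈ A. They are edge-disjoint because no coefficient vanishes, so triangle removal yields a
-- positive proportion of all triangles. A triangle amounts to a base point and a solution (p, q,
-- v), whose terms αp, βq, γv are the steps around it. The coefficients do not enter the bound.
theorem exists_le_card_three_term_solutions {δ : ℝ} (hδ : 0 < δ) :
    ∃ c : ℝ, 0 < c ∧ ∀ (Q : ℕ) [Fact Q.Prime] (α β γ : ZMod Q), α ≠ 0 → β ≠ 0 → γ ≠ 0 →
      α + β + γ = 0 → ∀ A : Finset (ZMod Q), δ * Q ≤ #A →
      c * Q ^ 2 ≤ #{p ∈ A ×ˢ A ×ˢ A | α * p.1 + β * p.2.1 + γ * p.2.2 = 0} := by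
  -- The graph has 3Q vertices: 9 = 3² normalises edges and 27 = 3³ normalises triangles.
  refine ⟨triangleRemovalBound (δ / 9) * 27,
    mul_pos (triangleRemovalBound_pos (by positivity)) (by norm_num), ?_⟩
  intro Q _ α β γ hα hβ hγ hsum A hA
  set t : Finset (ZMod Q × ZMod Q × ZMod Q) :=
    ((univ : Finset (ZMod Q)) ×ˢ A).image fun p => (p.1, p.1 + α * p.2, p.1 - γ * p.2) with ht
  have hmem : ∀ {a b c}, (a, b, c) ∈ t ↔ ∃ v ∈ A, b = a + α * v ∧ c = a - γ * v := by
    intro a b c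
    simp only [ht, mem_image, mem_product, mem_univ, true_and, Prod.mk.injEq, Prod.exists]
    constructor
    · rintro ⟨x, v, hv, rfl, rfl, rfl⟩
      exact ⟨v, hv, rfl, rfl⟩
    · rintro ⟨v, hv, rfl, rfl⟩
      exact ⟨a, v, hv, rfl, rfl, rfl⟩
  have hcardt : #t = Q * #A := by
    rw [ht, card_image_of_injOn, card_product, card_univ, ZMod.card]
    rintro ⟨x, v⟩ _ ⟨x', v'⟩ _ h
    simp only [Prod.mk.injEq] at h ⊢
    obtain ⟨rfl, h, -⟩ := h
    exact ⟨rfl, mul_left_cancel₀ hα (add_left_cancel h)⟩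
  have hdisj : ExplicitDisjoint t := by
    refine ⟨fun a b c a' h h' => ?_, fun a b c b' h h' => ?_, fun a b c c' h h' => ?_⟩
    · obtain ⟨v, _, h1, h2⟩ := hmem.1 h
      obtain ⟨v', _, h1', h2'⟩ := hmem.1 h'
      have : β * v = β * v' := by
        linear_combination hsum * (v - v') + h1 - h2 - h1' + h2'
      have := mul_left_cancel₀ hβ this
      subst this
      linear_combination h1' - h1
    · obtain ⟨v, _, h1, h2⟩ := hmem.1 h
      obtain ⟨v', _, h1', h2'⟩ := hmem.1 h'
      have : γ * v = γ * v' := by linear_combination h2 - h2'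
      rw [h1, h1', mul_left_cancel₀ hγ this]
    · obtain ⟨v, _, h1, h2⟩ := hmem.1 h
      obtain ⟨v', _, h1', h2'⟩ := hmem.1 h'
      have : α * v = α * v' := by linear_combination h1' - h1
      rw [h2, h2', mul_left_cancel₀ hα this]
  have hfar : (graph t).FarFromTriangleFree (δ / 9) := by
    refine farFromTriangleFree t ?_
    rw [hcardt, ZMod.card]
    push_cast
    nlinarith [Nat.cast_nonneg (α := ℝ) Q]
  have hle := hfar.le_card_cliqueFinset
  set sol := {p ∈ A ×ˢ A ×ˢ A | α * p.1 + β * p.2.1 + γ * p.2.2 = 0} with hsol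
  have hsub : (graph t).cliqueFinset 3 ⊆ ((univ : Finset (ZMod Q)) ×ˢ sol).image
      fun q => toTriangle (q.1, q.1 + α * q.2.1, q.1 - γ * q.2.2.2) := by
    intro s hs
    rw [mem_cliqueFinset_iff, SimpleGraph.is3Clique_iff] at hs
    obtain ⟨x, y, z, hxy, hxz, hyz, rfl⟩ := hs
    obtain ⟨a, b, c, habc, hab, hac, hbc⟩ := graph_triple hxy hxz hyz
    obtain ⟨c', hc'⟩ := Graph.in₀₁_iff.1 hab
    obtain ⟨b', hb'⟩ := Graph.in₀₂_iff.1 hac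
    obtain ⟨a', ha'⟩ := Graph.in₁₂_iff.1 hbc
    obtain ⟨p, hp, e1, -⟩ := hmem.1 hc'
    obtain ⟨v, hv, -, e2⟩ := hmem.1 hb'
    obtain ⟨q, hq, e3, e4⟩ := hmem.1 ha'
    refine mem_image.2 ⟨(a, p, q, v), ?_, ?_⟩
    · simp only [mem_product, mem_univ, true_and, hsol, mem_filter]
      refine ⟨⟨hp, hq, hv⟩, ?_⟩
      linear_combination hsum * q - e1 + e2 + e3 - e4
    · rw [← habc, ← e1, ← e2]
      rfl
  have hcl : #((graph t).cliqueFinset 3) ≤ Q * #sol := by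
    refine (card_le_card hsub).trans (card_image_le.trans ?_)
    rw [card_product, card_univ, ZMod.card]
  have hcl' : (#((graph t).cliqueFinset 3) : ℝ) ≤ Q * #sol := by exact_mod_cast hcl
  have hQ : (0 : ℝ) < Q := by exact_mod_cast (Fact.out : Q.Prime).pos
  have h := hle.trans hcl'
  simp only [Fintype.card_sum, ZMod.card] at h
  push_cast at h
  refine le_of_mul_le_mul_left ?_ hQ
  refine le_trans (le_of_eq ?_) h
  ring

/-- The number of ways to write `n = α₁x₁ + ⋯ + αₘxₘ` with all `xᵢ ∈ A`, where `[α₁, …, αₘ]` is the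
given list of coefficients. -/
def linearCount {Q : ℕ} (A : Finset (ZMod Q)) : List (ZMod Q) → ZMod Q → ℕ
  | [], n => if n = 0 then 1 else 0
  | α :: l, n => ∑ v ∈ A, linearCount A l (n - α * v)

theorem linearCount_perm {Q : ℕ} (A : Finset (ZMod Q)) {l l' : List (ZMod Q)} (h : l.Perm l') :
    ∀ n, linearCount A l n = linearCount A l' n := by
  induction h with
  | nil => intro n; rfl
  | cons α _ ih => intro n; exact Finset.sum_congr rfl fun v _ => ih _
  | swap α β l =>
    intro n
    simp only [linearCount]
    rw [Finset.sum_comm]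
    simp only [sub_right_comm]
  | trans _ _ ih ih' => intro n; rw [ih, ih']

theorem linearCount_mono {Q : ℕ} {A B : Finset (ZMod Q)} (h : A ⊆ B) (l : List (ZMod Q)) :
    ∀ n, linearCount A l n ≤ linearCount B l n := by
  induction l with
  | nil => intro n; exact le_rfl
  | cons α l ih =>
    intro n
    exact (Finset.sum_le_sum fun v _ => ih _).trans
      (Finset.sum_le_sum_of_subset h)

open Finset in
-- Two coefficients are merged. With γ = −(α + β), the equation splits into αp + βq + γv = 0 and a
-- representation of γv by `l`. Call v good if γv has many representations. The bad v cannot be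
-- dense, as `h₁` for `-γ :: l` on the bad set would contradict badness. Hence the good v are dense,
-- and each three-term solution among them extends in many ways.
theorem mul_pow_le_linearCount_cons_cons {δ c₁ c₃ : ℝ} (hδ : 0 < δ) (hc₁ : 0 < c₁) {m : ℕ}
    {Q : ℕ} [Fact Q.Prime]
    (h₁ : ∀ l : List (ZMod Q), l.length = m + 1 → l.sum = 0 → ∀ A : Finset (ZMod Q),
      δ / 2 * Q ≤ #A → c₁ * Q ^ (m + 1) ≤ Q * linearCount A l 0)
    (h₃ : ∀ (α β γ : ZMod Q), α ≠ 0 → β ≠ 0 → γ ≠ 0 → α + β + γ = 0 → ∀ A : Finset (ZMod Q),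
      δ / 2 * Q ≤ #A → c₃ * Q ^ 2 ≤ #{p ∈ A ×ˢ A ×ˢ A | α * p.1 + β * p.2.1 + γ * p.2.2 = 0})
    {α β : ZMod Q} {l : List (ZMod Q)} (hl : l.length = m) (hα : α ≠ 0) (hβ : β ≠ 0)
    (hαβ : α + β ≠ 0) (hsum : (α :: β :: l).sum = 0) {A : Finset (ZMod Q)} (hA : δ * Q ≤ #A) :
    c₃ * c₁ * Q ^ (m + 2) ≤ Q * linearCount A (α :: β :: l) 0 := by
  have hQ : (0 : ℝ) < Q := by exact_mod_cast (Fact.out : Q.Prime).pos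
  set γ := -(α + β) with hγ
  have hl_sum : l.sum = γ := by
    simp only [List.sum_cons] at hsum
    linear_combination hsum
  set bad := {v ∈ A | (Q * linearCount A l (γ * v) : ℝ) < c₁ * Q ^ m} with hbad
  set good := {v ∈ A | ¬ (Q * linearCount A l (γ * v) : ℝ) < c₁ * Q ^ m} with hgood
  have hcard : (#bad : ℝ) + #good = #A := by
    exact_mod_cast card_filter_add_card_filter_not (s := A) _
  have hbadlt : (#bad : ℝ) < δ / 2 * Q := by
    by_contra! h
    have hne : bad.Nonempty := by
      rw [← card_pos]
      have : (0 : ℝ) < #bad := lt_of_lt_of_le (by positivity) h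
      exact_mod_cast this
    have h1 := h₁ (-γ :: l) (by simp [hl]) (by simp [hl_sum]) bad h
    have h2 : (Q * linearCount bad (-γ :: l) 0 : ℝ) < ∑ v ∈ bad, c₁ * Q ^ m := by
      simp only [linearCount]
      push_cast
      rw [mul_sum]
      refine sum_lt_sum_of_nonempty hne fun v hv => ?_
      refine lt_of_le_of_lt ?_ (mem_filter.1 hv).2
      have : 0 - -γ * v = γ * v := by ring
      rw [this]
      gcongr
      exact linearCount_mono (filter_subset _ _) _ _
    rw [sum_const, nsmul_eq_mul] at h2
    have h3 : (#bad : ℝ) ≤ Q := by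
      have := card_le_univ bad
      rw [ZMod.card] at this
      exact_mod_cast this
    have h4 : (#bad : ℝ) * (c₁ * Q ^ m) ≤ Q * (c₁ * Q ^ m) := by gcongr
    rw [pow_succ] at h1
    linarith
  have hgoodle : δ / 2 * Q ≤ #good := by linarith
  have h3 := h₃ α β γ hα hβ (neg_ne_zero.2 hαβ) (by rw [hγ]; ring) good hgoodle
  set sol := {p ∈ good ×ˢ good ×ˢ good | α * p.1 + β * p.2.1 + γ * p.2.2 = 0} with hsol
  have hinj : Set.InjOn (fun p : ZMod Q × ZMod Q × ZMod Q => (p.1, p.2.1)) sol := by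
    rintro ⟨p, q, v⟩ h ⟨p', q', v'⟩ h' he
    simp only [hsol, coe_filter, Set.mem_ofPred_eq, Prod.mk.injEq] at h h' he ⊢
    obtain ⟨rfl, rfl⟩ := he
    refine ⟨rfl, rfl, mul_left_cancel₀ (neg_ne_zero.2 hαβ) ?_⟩
    linear_combination h.2 - h'.2
  have hsub : sol.image (fun p => (p.1, p.2.1)) ⊆ A ×ˢ A := by
    intro x hx
    obtain ⟨p, hp, rfl⟩ := mem_image.1 hx
    simp only [hsol, hgood, mem_filter, mem_product] at hp
    exact mem_product.2 ⟨hp.1.1.1, hp.1.2.1.1⟩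
  calc c₃ * c₁ * Q ^ (m + 2) = c₃ * Q ^ 2 * (c₁ * Q ^ m) := by ring
    _ ≤ #sol * (c₁ * Q ^ m) := by gcongr
    _ = ∑ p ∈ sol, c₁ * Q ^ m := by rw [sum_const, nsmul_eq_mul]
    _ ≤ ∑ p ∈ sol, (Q * linearCount A l (0 - α * p.1 - β * p.2.1) : ℝ) := by
        refine sum_le_sum fun p hp => ?_
        have hp' := mem_filter.1 hp
        have : 0 - α * p.1 - β * p.2.1 = γ * p.2.2 := by linear_combination -hp'.2
        rw [this]
        have := (mem_product.1 (mem_product.1 hp'.1).2).2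
        exact not_lt.1 (mem_filter.1 this).2
    _ = ∑ x ∈ sol.image (fun p => (p.1, p.2.1)),
          (Q * linearCount A l (0 - α * x.1 - β * x.2) : ℝ) := by
        rw [sum_image hinj]
    _ ≤ ∑ x ∈ A ×ˢ A, (Q * linearCount A l (0 - α * x.1 - β * x.2) : ℝ) :=
        sum_le_sum_of_subset_of_nonneg hsub fun _ _ _ => by positivity
    _ = Q * linearCount A (α :: β :: l) 0 := by
        rw [sum_product]
        simp only [linearCount]
        push_cast
        simp only [mul_sum]

open Finset in
theorem linearCount_zero_cons {Q : ℕ} (A : Finset (ZMod Q)) (l : List (ZMod Q)) (n : ZMod Q) :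
    linearCount A (0 :: l) n = #A * linearCount A l n := by
  simp [linearCount]

open Finset in
/-- Dense subsets of `ZMod Q` contain a positive proportion of the solutions of any
translation-invariant linear equation, uniformly in the coefficients. -/
theorem exists_le_linearCount (n : ℕ) : ∀ {δ : ℝ}, 0 < δ → ∃ c : ℝ, 0 < c ∧
    ∀ (Q : ℕ) [Fact Q.Prime], Q ≠ 2 → ∀ l : List (ZMod Q), l.length = n → l.sum = 0 →
      ∀ A : Finset (ZMod Q), δ * Q ≤ #A → c * Q ^ n ≤ Q * linearCount A l 0 := by
  induction n with
  | zero =>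
    refine fun {δ} hδ => ⟨1, one_pos, fun Q hQ _ l hl _ A _ => ?_⟩
    rw [List.length_eq_zero_iff.1 hl]
    have : (1 : ℝ) ≤ Q := by exact_mod_cast hQ.out.one_le
    simpa [linearCount] using this
  | succ n ih =>
    intro δ hδ
    obtain ⟨c₀, hc₀, h₀⟩ := ih hδ
    obtain ⟨c₁, hc₁, h₁⟩ := ih (half_pos hδ)
    obtain ⟨c₃, hc₃, h₃⟩ := exists_le_card_three_term_solutions (half_pos hδ)
    refine ⟨min (min δ (δ * c₀)) (c₃ * c₁), by positivity, fun Q hQ hQ2 l hl hsum A hA => ?_⟩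
    have hQ0 : (0 : ℝ) < Q := by exact_mod_cast hQ.out.pos
    have hzero : ∀ l' : List (ZMod Q), l.Perm (0 :: l') →
        min (min δ (δ * c₀)) (c₃ * c₁) * (Q : ℝ) ^ (n + 1) ≤ Q * linearCount A l 0 := by
      intro l' hp
      rw [linearCount_perm A hp, linearCount_zero_cons]
      have hlen : l'.length = n := by simpa [hl] using hp.length_eq.symm
      have hs : l'.sum = 0 := by simpa [hsum] using hp.sum_eq.symm
      calc _ ≤ δ * c₀ * (Q : ℝ) ^ (n + 1) := by
            gcongr; exact (min_le_left _ _).trans (min_le_right _ _)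
        _ = (δ * Q) * (c₀ * Q ^ n) := by ring
        _ ≤ #A * (Q * linearCount A l' 0) := by
            exact mul_le_mul hA (h₀ Q hQ2 l' hlen hs A hA) (by positivity) (by positivity)
        _ = _ := by push_cast; ring
    have hmain : ∀ (α β : ZMod Q) (l' : List (ZMod Q)), l.Perm (α :: β :: l') → α ≠ 0 → β ≠ 0 →
        α + β ≠ 0 →
        min (min δ (δ * c₀)) (c₃ * c₁) * (Q : ℝ) ^ (n + 1) ≤ Q * linearCount A l 0 := by
      intro α β l' hp hα hβ hαβ
      rw [linearCount_perm A hp]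
      obtain ⟨m, rfl⟩ : ∃ m, n = m + 1 := ⟨l'.length, by
        have := hp.length_eq
        rw [hl] at this
        simpa using this⟩
      have hlen : l'.length = m := by
        have := hp.length_eq
        rw [hl] at this
        simpa using this.symm
      refine le_trans ?_ (mul_pow_le_linearCount_cons_cons hδ hc₁
        (h₁ Q hQ2) (h₃ Q) hlen hα hβ hαβ (hp.sum_eq ▸ hsum) hA)
      gcongr
      exact min_le_right _ _
    match l, hl, hsum with
    | [α], hl, hsum =>
      have : α = 0 := by simpa using hsum
      subst this
      exact hzero [] (List.Perm.refl _)
    | [α, β], hl, hsum =>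
      have hβ : β = -α := by
        simp only [List.sum_cons, List.sum_nil, add_zero] at hsum
        linear_combination hsum
      have hn : n = 1 := by simpa using hl.symm
      subst hn
      have hle : #A ≤ linearCount A [α, β] 0 := by
        simp only [linearCount]
        rw [card_eq_sum_ones]
        refine sum_le_sum fun v hv => ?_
        refine le_trans (le_of_eq ?_) (single_le_sum (f := fun w =>
          if 0 - α * v - β * w = 0 then 1 else 0) (fun _ _ => Nat.zero_le _) hv)
        simp [hβ]
      have hle' : (#A : ℝ) ≤ linearCount A [α, β] 0 := by exact_mod_cast hle
      calc _ ≤ δ * (Q : ℝ) ^ 2 := by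
            gcongr; exact (min_le_left _ _).trans (min_le_left _ _)
        _ = Q * (δ * Q) := by ring
        _ ≤ _ := by gcongr; exact hA.trans hle'
    | α :: β :: γ :: l', hl, hsum =>
      by_cases hα : α = 0
      · subst hα
        exact hzero _ (List.Perm.refl _)
      by_cases hβ : β = 0
      · subst hβ
        exact hzero _ (List.Perm.swap _ _ _)
      by_cases hγ : γ = 0
      · subst hγ
        exact hzero (α :: β :: l')
          (((List.Perm.swap _ _ _).cons _).trans (List.Perm.swap _ _ _))
      -- Among three non-zero coefficients some pair has non-zero sum, since otherwise 2α = 0 with Q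
      -- odd. That pair is merged.
      by_cases hαβ : α + β = 0
      · by_cases hαγ : α + γ = 0
        · by_cases hβγ : β + γ = 0
          · exfalso
            have h2 : (2 : ZMod Q) * α = 0 := by linear_combination hαβ + hαγ - hβγ
            rcases mul_eq_zero.1 h2 with h2 | h2
            · have : ((2 : ℕ) : ZMod Q) = 0 := by exact_mod_cast h2
              rw [ZMod.natCast_eq_zero_iff] at this
              exact hQ2 ((Nat.prime_dvd_prime_iff_eq hQ.out Nat.prime_two).1 this)
            · exact hα h2
          · exact hmain β γ (α :: l')
              ((List.Perm.swap _ _ _).trans ((List.Perm.swap _ _ _).cons _)) hβ hγ hβγ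
        · exact hmain α γ (β :: l') ((List.Perm.swap _ _ _).cons _) hα hγ hαγ
      · exact hmain α β _ (List.Perm.refl _) hα hβ hαβ

/-! ### Fourier analysis on ZMod Q and moment inequalities -/

theorem sum_stdAddChar_mul {Q : ℕ} [NeZero Q] (n : ZMod Q) :
    ∑ ξ : ZMod Q, ZMod.stdAddChar (ξ * n) = if n = 0 then (Q : ℂ) else 0 := by
  rw [AddChar.sum_mulShift n (ZMod.isPrimitive_stdAddChar Q), ZMod.card]
  push_cast
  rfl

open Finset in
theorem sum_norm_sq_sum_stdAddChar {Q : ℕ} [NeZero Q] {τ : Type*} (T : Finset τ)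
    (φ : τ → ZMod Q) :
    ∑ ξ : ZMod Q, ‖∑ p ∈ T, ZMod.stdAddChar (ξ * φ p)‖ ^ 2 =
      Q * #{p ∈ T ×ˢ T | φ p.1 = φ p.2} := by
  have h : ∀ ξ : ZMod Q, ((‖∑ p ∈ T, ZMod.stdAddChar (ξ * φ p)‖ ^ 2 : ℝ) : ℂ) =
      ∑ p ∈ T ×ˢ T, ZMod.stdAddChar (ξ * (φ p.1 - φ p.2)) := by
    intro ξ
    push_cast
    rw [← Complex.mul_conj', map_sum, sum_mul_sum, sum_product]
    refine sum_congr rfl fun p _ => sum_congr rfl fun q _ => ?_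
    rw [← AddChar.map_neg_eq_conj, ← AddChar.map_add_eq_mul]
    congr 1
    ring
  have h' : ((∑ ξ : ZMod Q, ‖∑ p ∈ T, ZMod.stdAddChar (ξ * φ p)‖ ^ 2 : ℝ) : ℂ) =
      ((Q * #{p ∈ T ×ˢ T | φ p.1 = φ p.2} : ℝ) : ℂ) := by
    rw [Complex.ofReal_sum, sum_congr rfl fun ξ _ => h ξ, sum_comm]
    simp only [sum_stdAddChar_mul, sub_eq_zero]
    rw [← sum_filter, sum_const, nsmul_eq_mul]
    push_cast
    ring
  exact_mod_cast h'

/-- The (unnormalised) Fourier transform of the indicator function of `A`. -/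
noncomputable def indicatorDFT {Q : ℕ} [NeZero Q] (A : Finset (ZMod Q)) (ξ : ZMod Q) : ℂ :=
  ∑ x ∈ A, ZMod.stdAddChar (ξ * x)

open Finset in
theorem norm_sum_stdAddChar_le {Q : ℕ} [NeZero Q] {τ : Type*} (T : Finset τ) (φ : τ → ZMod Q) :
    ‖∑ p ∈ T, ZMod.stdAddChar (φ p)‖ ≤ #T := by
  refine (norm_sum_le _ _).trans ?_
  simp

open Finset in
theorem norm_indicatorDFT_le {Q : ℕ} [NeZero Q] (A : Finset (ZMod Q)) (ξ : ZMod Q) :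
    ‖indicatorDFT A ξ‖ ≤ Q := by
  refine (norm_sum_stdAddChar_le A _).trans ?_
  have := card_le_univ A
  rw [ZMod.card] at this
  exact_mod_cast this

open Finset in
theorem sum_norm_sq_indicatorDFT_le {Q : ℕ} [Fact Q.Prime] (A : Finset (ZMod Q)) {c : ZMod Q}
    (hc : c ≠ 0) : ∑ ξ : ZMod Q, ‖indicatorDFT A (c * ξ)‖ ^ 2 ≤ (Q : ℝ) ^ 2 := by
  have h : ∀ ξ, indicatorDFT A (c * ξ) = ∑ x ∈ A, ZMod.stdAddChar (ξ * (c * x)) := fun ξ =>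
    sum_congr rfl fun x _ => by congr 1; ring
  simp only [h]
  rw [sum_norm_sq_sum_stdAddChar, sq]
  gcongr
  have : #{p ∈ A ×ˢ A | c * p.1 = c * p.2} ≤ #(univ : Finset (ZMod Q)) := by
    refine card_le_card_of_injOn (fun p => p.1) (fun _ _ => mem_coe.2 (mem_univ _)) ?_
    rintro ⟨x, y⟩ hx ⟨x', y'⟩ hx' h
    simp only [coe_filter, Set.mem_ofPred_eq] at hx hx' h
    have e1 := mul_left_cancel₀ hc hx.2
    have e2 := mul_left_cancel₀ hc hx'.2
    simp only [Prod.mk.injEq]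
    exact ⟨h, by rw [← e1, ← e2, h]⟩
  rw [card_univ, ZMod.card] at this
  exact_mod_cast this

theorem sum_prod_indicatorDFT {Q : ℕ} [NeZero Q] (A : Finset (ZMod Q)) (l : List (ZMod Q)) :
    ∀ n : ZMod Q, ∑ ξ : ZMod Q, (l.map fun α => indicatorDFT A (α * ξ)).prod *
      ZMod.stdAddChar (ξ * -n) = Q * linearCount A l n := by
  induction l with
  | nil =>
    intro n
    simp only [List.map_nil, List.prod_nil, one_mul, sum_stdAddChar_mul, linearCount, neg_eq_zero]
    split_ifs <;> simp
  | cons α l ih =>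
    intro n
    simp only [List.map_cons, List.prod_cons, linearCount]
    push_cast
    rw [Finset.mul_sum]
    simp only [← ih]
    rw [Finset.sum_comm]
    refine Finset.sum_congr rfl fun ξ _ => ?_
    rw [indicatorDFT, Finset.sum_mul, Finset.sum_mul]
    refine Finset.sum_congr rfl fun v _ => ?_
    rw [mul_comm (ZMod.stdAddChar _), mul_assoc, ← AddChar.map_add_eq_mul]
    congr 2
    ring

open Finset in
theorem sum_mul_le_of_sum_sq_le {τ : Type*} (T : Finset τ) {P R : τ → ℝ} {x y : ℝ} (hx : 0 ≤ x)
    (hy : 0 ≤ y) (hP : ∑ t ∈ T, P t ^ 2 ≤ x ^ 2) (hR : ∑ t ∈ T, R t ^ 2 ≤ y ^ 2) :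
    ∑ t ∈ T, P t * R t ≤ x * y := by
  refine le_of_sq_le_sq ?_ (by positivity)
  calc (∑ t ∈ T, P t * R t) ^ 2 ≤ (∑ t ∈ T, P t ^ 2) * ∑ t ∈ T, R t ^ 2 :=
        sum_mul_sq_le_sq_mul_sq _ _ _
    _ ≤ x ^ 2 * y ^ 2 := by gcongr
    _ = (x * y) ^ 2 := by ring

open Finset in
-- Hölder for P^(2/3) · (P^(1/3) G) · R with exponents 3, 6, 2, obtained by repeated Cauchy–Schwarz.
-- The weight P² on G⁶ is what allows smallness of P to be combined with the full sixth moment of G.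
theorem sum_mul_mul_pow_six_le {τ : Type*} (T : Finset τ) (P R G : τ → ℝ) :
    (∑ t ∈ T, P t * R t * G t) ^ 6 ≤
      (∑ t ∈ T, P t ^ 2) ^ 2 * (∑ t ∈ T, P t ^ 2 * G t ^ 6) * (∑ t ∈ T, R t ^ 2) ^ 3 := by
  set S₀ := ∑ t ∈ T, P t ^ 2
  set S₂ := ∑ t ∈ T, P t ^ 2 * G t ^ 2 with hS₂
  set S₄ := ∑ t ∈ T, P t ^ 2 * G t ^ 4 with hS₄
  set S₆ := ∑ t ∈ T, P t ^ 2 * G t ^ 6 with hS₆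
  have n0 : 0 ≤ S₀ := sum_nonneg fun t _ => by positivity
  have n2 : 0 ≤ S₂ := sum_nonneg fun t _ => by positivity
  have n4 : 0 ≤ S₄ := sum_nonneg fun t _ => by positivity
  have n6 : 0 ≤ S₆ := sum_nonneg fun t _ => by positivity
  have h1 : (∑ t ∈ T, P t * R t * G t) ^ 2 ≤ S₂ * ∑ t ∈ T, R t ^ 2 := by
    have := sum_mul_sq_le_sq_mul_sq T (fun t => P t * G t) R
    simp only [mul_pow] at this
    refine le_trans (le_of_eq ?_) this
    congr 1
    exact sum_congr rfl fun t _ => by ring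
  have h2 : S₂ ^ 2 ≤ S₀ * S₄ := by
    have := sum_mul_sq_le_sq_mul_sq T P (fun t => P t * G t ^ 2)
    refine le_trans (le_of_eq ?_) (this.trans (le_of_eq ?_))
    · rw [hS₂]; congr 1; exact sum_congr rfl fun t _ => by ring
    · rw [hS₄]; congr 1; exact sum_congr rfl fun t _ => by ring
  have h3 : S₄ ^ 2 ≤ S₂ * S₆ := by
    have := sum_mul_sq_le_sq_mul_sq T (fun t => P t * G t) (fun t => P t * G t ^ 3)
    refine le_trans (le_of_eq ?_) (this.trans (le_of_eq ?_))
    · rw [hS₄]; congr 1; exact sum_congr rfl fun t _ => by ring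
    · rw [hS₂, hS₆]
      congr 1
      · exact sum_congr rfl fun t _ => by ring
      · exact sum_congr rfl fun t _ => by ring
  have h4 : S₂ ^ 3 ≤ S₀ ^ 2 * S₆ := by
    rcases n2.eq_or_lt with h | h
    · rw [← h, zero_pow three_ne_zero]; positivity
    · refine le_of_mul_le_mul_left ?_ h
      calc S₂ * S₂ ^ 3 = (S₂ ^ 2) ^ 2 := by ring
        _ ≤ (S₀ * S₄) ^ 2 := by gcongr
        _ = S₀ ^ 2 * S₄ ^ 2 := by ring
        _ ≤ S₀ ^ 2 * (S₂ * S₆) := by gcongr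
        _ = _ := by ring
  calc (∑ t ∈ T, P t * R t * G t) ^ 6 = ((∑ t ∈ T, P t * R t * G t) ^ 2) ^ 3 := by ring
    _ ≤ (S₂ * ∑ t ∈ T, R t ^ 2) ^ 3 := by gcongr
    _ = S₂ ^ 3 * (∑ t ∈ T, R t ^ 2) ^ 3 := by ring
    _ ≤ _ := by
        gcongr

open Finset in
-- Parseval for the cube of the sum counts pairs of triples with congruent sums of squares. Since
-- 3X² < Q, congruence is equality.
theorem sum_norm_pow_six_sq_le {Q : ℕ} [Fact Q.Prime] {X : ℕ} {D : Finset ℕ} (hD : D ⊆ Icc 1 X)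
    (hX : 3 * X ^ 2 < Q) {b : ZMod Q} (hb : b ≠ 0) :
    ∑ ξ : ZMod Q, ‖∑ y ∈ D, ZMod.stdAddChar (ξ * (b * (y : ZMod Q) ^ 2))‖ ^ 6 ≤
      Q * (192 * X ^ 4) := by
  have h : ∀ ξ : ZMod Q, ‖∑ y ∈ D, ZMod.stdAddChar (ξ * (b * (y : ZMod Q) ^ 2))‖ ^ 6 =
      ‖∑ p ∈ D ×ˢ D ×ˢ D, ZMod.stdAddChar
        (ξ * (b * ((p.1 ^ 2 + p.2.1 ^ 2 + p.2.2 ^ 2 : ℕ) : ZMod Q)))‖ ^ 2 := by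
    intro ξ
    have : ∑ p ∈ D ×ˢ D ×ˢ D, ZMod.stdAddChar
        (ξ * (b * ((p.1 ^ 2 + p.2.1 ^ 2 + p.2.2 ^ 2 : ℕ) : ZMod Q))) =
        (∑ y ∈ D, ZMod.stdAddChar (ξ * (b * (y : ZMod Q) ^ 2))) ^ 3 := by
      rw [pow_succ', sq, sum_mul_sum, sum_mul_sum, sum_product]
      refine sum_congr rfl fun x _ => ?_
      rw [sum_product]
      refine sum_congr rfl fun y _ => ?_
      rw [mul_sum]
      refine sum_congr rfl fun z _ => ?_
      rw [← AddChar.map_add_eq_mul, ← AddChar.map_add_eq_mul]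
      congr 1
      push_cast
      ring
    rw [this, norm_pow, ← pow_mul]
  rw [sum_congr rfl fun ξ _ => h ξ, sum_norm_sq_sum_stdAddChar]
  gcongr
  have hle := card_sum_three_sq_eq_le X D hD
  refine le_trans ?_ (by exact_mod_cast hle : ((#{p ∈ (D ×ˢ D ×ˢ D) ×ˢ (D ×ˢ D ×ˢ D) |
      p.1.1 ^ 2 + p.1.2.1 ^ 2 + p.1.2.2 ^ 2 = p.2.1 ^ 2 + p.2.2.1 ^ 2 + p.2.2.2 ^ 2} : ℕ) : ℝ) ≤
      192 * X ^ 4)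
  norm_cast
  refine card_le_card fun p hp => ?_
  simp only [mem_filter, mem_product] at hp ⊢
  refine ⟨hp.1, ?_⟩
  have hsmall : ∀ x y z : ℕ, x ∈ D → y ∈ D → z ∈ D → x ^ 2 + y ^ 2 + z ^ 2 < Q := by
    intro x y z hx hy hz
    have h1 := Nat.pow_le_pow_left (mem_Icc.1 (hD hx)).2 2
    have h2 := Nat.pow_le_pow_left (mem_Icc.1 (hD hy)).2 2
    have h3 := Nat.pow_le_pow_left (mem_Icc.1 (hD hz)).2 2
    omega
  have := mul_left_cancel₀ hb hp.2
  rw [ZMod.natCast_eq_natCast_iff'] at this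
  rwa [Nat.mod_eq_of_lt (hsmall _ _ _ hp.1.1.1 hp.1.1.2.1 hp.1.1.2.2),
    Nat.mod_eq_of_lt (hsmall _ _ _ hp.1.2.1 hp.1.2.2.1 hp.1.2.2.2)] at this

open Finset in
theorem norm_prod_le_mul_mul_pow {ι : Type*} [DecidableEq ι] {S : Finset ι} {g : ι → ℂ} {K : ℝ}
    (hg : ∀ i, ‖g i‖ ≤ K) {i j : ι} (hi : i ∈ S) (hj : j ∈ S) (hij : i ≠ j) :
    ‖∏ k ∈ S, g k‖ ≤ ‖g i‖ * ‖g j‖ * K ^ (#S - 2) := by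
  rw [← mul_prod_erase S g hi, ← mul_prod_erase (S.erase i) g (mem_erase.2 ⟨hij.symm, hj⟩),
    norm_mul, norm_mul, ← mul_assoc]
  gcongr
  rw [norm_prod]
  refine (prod_le_prod (fun _ _ => norm_nonneg _) fun k _ => hg k).trans (le_of_eq ?_)
  rw [prod_const, card_erase_of_mem (mem_erase.2 ⟨hij.symm, hj⟩), card_erase_of_mem hi]
  rfl

/-! ### Large, intermediate and small spectrum -/

open Finset in
/-- The contribution of the large spectrum of a dense set to the number of solutions of a
translation-invariant equation is of the expected order. -/
theorem exists_le_re_sum_large_spectrum (h : ℕ) (hh : 2 ≤ h) {δ : ℝ} (hδ : 0 < δ) :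
    ∃ c : ℝ, 0 < c ∧ ∃ η₀ : ℝ, 0 < η₀ ∧ ∀ (Q : ℕ) [Fact Q.Prime], Q ≠ 2 →
      ∀ {ι : Type} [DecidableEq ι] (S : Finset ι) (a : ι → ZMod Q), #S = h →
      (∀ i, a i ≠ 0) → ∑ i ∈ S, a i = 0 → ∀ i₀ ∈ S, ∀ A : Finset (ZMod Q), δ * Q ≤ #A →
      ∀ η, 0 ≤ η → η ≤ η₀ →
      c * Q ^ h ≤
        (∑ ξ : ZMod Q with η * Q ≤ ‖indicatorDFT A (a i₀ * ξ)‖,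
          ∏ i ∈ S, indicatorDFT A (a i * ξ)).re := by
  -- With two variables there are no two further factors for Cauchy–Schwarz. The coefficients are
  -- then opposite, every term is a squared modulus, and frequency 0 alone suffices.
  rcases hh.eq_or_lt with rfl | hh
  · refine ⟨δ ^ 2, by positivity, δ, hδ, ?_⟩
    intro Q _ _ ι _ S a hS _ hsum i₀ hi₀ A hA η hη0 hη
    obtain ⟨i₁, hi₁⟩ : ∃ i₁, S.erase i₀ = {i₁} := by
      rw [← card_eq_one, card_erase_of_mem hi₀, hS]
    have hprod : ∀ ξ, ∏ i ∈ S, indicatorDFT A (a i * ξ) =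
        ((‖indicatorDFT A (a i₀ * ξ)‖ ^ 2 : ℝ) : ℂ) := by
      intro ξ
      have ha : a i₁ = -a i₀ := by
        rw [← add_sum_erase S a hi₀, hi₁, sum_singleton] at hsum
        linear_combination hsum
      rw [← mul_prod_erase S _ hi₀, hi₁, prod_singleton, ha]
      push_cast
      rw [← Complex.mul_conj']
      congr 1
      simp only [indicatorDFT, map_sum]
      refine sum_congr rfl fun x _ => ?_
      rw [← AddChar.map_neg_eq_conj]
      congr 1
      ring
    simp only [hprod]
    rw [Complex.re_sum]
    simp only [Complex.ofReal_re]
    have h0 : ‖indicatorDFT A (a i₀ * 0)‖ = #A := by simp [indicatorDFT]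
    have hmem : (0 : ZMod Q) ∈ ({ξ : ZMod Q | η * Q ≤ ‖indicatorDFT A (a i₀ * ξ)‖} :
        Finset (ZMod Q)) := by
      rw [mem_filter, h0]
      exact ⟨mem_univ _, le_trans (by gcongr) hA⟩
    refine le_trans ?_ (single_le_sum (f := fun ξ => ‖indicatorDFT A (a i₀ * ξ)‖ ^ 2)
      (fun _ _ => by positivity) hmem)
    simp only [h0]
    rw [← mul_pow]
    gcongr
  · obtain ⟨c, hc, hcount⟩ := exists_le_linearCount h hδ
    refine ⟨c / 2, by positivity, c / 2, by positivity, ?_⟩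
    intro Q hQ hQ2 ι _ S a hS ha hsum i₀ hi₀ A hA η hη0 hη
    have hQ0 : (0 : ℝ) < Q := by exact_mod_cast hQ.out.pos
    have htot : ∑ ξ : ZMod Q, ∏ i ∈ S, indicatorDFT A (a i * ξ) =
        Q * linearCount A (S.toList.map a) 0 := by
      rw [← sum_prod_indicatorDFT]
      refine sum_congr rfl fun ξ _ => ?_
      rw [neg_zero, mul_zero, AddChar.map_zero_eq_one, mul_one, List.map_map]
      exact (prod_map_toList S _).symm
    have hlow := hcount Q hQ2 (S.toList.map a) (by simpa using hS)
      (by rw [sum_map_toList]; exact hsum) A hA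
    obtain ⟨i₁, hi₁, i₂, hi₂, h12⟩ : ∃ i₁ ∈ S.erase i₀, ∃ i₂ ∈ S.erase i₀, i₁ ≠ i₂ := by
      refine one_lt_card.1 ?_
      rw [card_erase_of_mem hi₀]
      omega
    -- Off the large spectrum one factor is below ηQ, two others are summed by Cauchy–Schwarz and
    -- Parseval, and the rest are bounded by Q.
    have hsmall : ‖∑ ξ : ZMod Q with ¬ η * Q ≤ ‖indicatorDFT A (a i₀ * ξ)‖,
        ∏ i ∈ S, indicatorDFT A (a i * ξ)‖ ≤ η * Q ^ h := by
      refine (norm_sum_le _ _).trans ?_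
      calc _ ≤ ∑ ξ : ZMod Q with ¬ η * Q ≤ ‖indicatorDFT A (a i₀ * ξ)‖,
            η * Q * (‖indicatorDFT A (a i₁ * ξ)‖ * ‖indicatorDFT A (a i₂ * ξ)‖) *
              Q ^ (h - 3) := by
            refine sum_le_sum fun ξ hξ => ?_
            rw [← mul_prod_erase S _ hi₀, norm_mul, mul_assoc]
            refine mul_le_mul (not_le.1 (mem_filter.1 hξ).2).le ?_ (norm_nonneg _) (by positivity)
            refine (norm_prod_le_mul_mul_pow (fun i => norm_indicatorDFT_le A (a i * ξ))
              hi₁ hi₂ h12).trans (le_of_eq ?_)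
            rw [card_erase_of_mem hi₀, hS]
            rfl
        _ ≤ ∑ ξ : ZMod Q, η * Q * (‖indicatorDFT A (a i₁ * ξ)‖ * ‖indicatorDFT A (a i₂ * ξ)‖) *
              Q ^ (h - 3) :=
            sum_le_sum_of_subset_of_nonneg (filter_subset _ _) fun _ _ _ => by positivity
        _ = η * Q * (∑ ξ : ZMod Q, ‖indicatorDFT A (a i₁ * ξ)‖ * ‖indicatorDFT A (a i₂ * ξ)‖) *
              Q ^ (h - 3) := by rw [← sum_mul, ← mul_sum]
        _ ≤ η * Q * (Q * Q) * Q ^ (h - 3) := by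
            gcongr
            exact sum_mul_le_of_sum_sq_le _ hQ0.le hQ0.le (sum_norm_sq_indicatorDFT_le A (ha i₁))
              (sum_norm_sq_indicatorDFT_le A (ha i₂))
        _ = η * Q ^ h := by
            obtain ⟨m, rfl⟩ : ∃ m, h = m + 3 := ⟨h - 3, by omega⟩
            rw [Nat.add_sub_cancel]
            ring
    rw [← sum_filter_add_sum_filter_not univ
      (fun ξ => η * Q ≤ ‖indicatorDFT A (a i₀ * ξ)‖)] at htot
    have hre := congrArg Complex.re htot
    rw [Complex.add_re] at hre
    have hval : ((Q : ℂ) * (linearCount A (S.toList.map a) 0 : ℂ)).re =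
        (Q : ℝ) * linearCount A (S.toList.map a) 0 := by
      rw [← Complex.ofReal_natCast, ← Complex.ofReal_natCast, ← Complex.ofReal_mul,
        Complex.ofReal_re]
    rw [hval] at hre
    have h1 := (Complex.re_le_norm _).trans hsmall
    have h2 : η * (Q : ℝ) ^ h ≤ c / 2 * Q ^ h := by gcongr
    linarith

open Finset in
/-- Lower bound for a correlation `∑ f w` in which `w` is nearly constant where `P` is large, the
energy of `P` at intermediate heights is small, and `w` satisfies a moment bound where `P` is
small. -/
theorem le_re_sum_mul_of_spectrum_split {τ : Type*} [Fintype τ] {f w : τ → ℂ} {P R G : τ → ℝ}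
    {q κ W V T τ₀ c ρ ε η η' : ℝ} (hq : 0 ≤ q) (hκ : 0 ≤ κ) (hW : 0 ≤ W) (hV : 0 ≤ V)
    (hτ₀ : 0 ≤ τ₀) (hρ : 0 ≤ ρ) (hε : 0 ≤ ε) (hη : η' ≤ η) (hP0 : ∀ t, 0 ≤ P t)
    (hR0 : ∀ t, 0 ≤ R t) (hG0 : ∀ t, 0 ≤ G t) (hP : ∑ t, P t ^ 2 ≤ q ^ 2)
    (hR : ∑ t, R t ^ 2 ≤ q ^ 2) (hf : ∀ t, ‖f t‖ ≤ κ * (P t * R t)) (hw : ∀ t, ‖w t‖ ≤ W)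
    (hbig : ∀ t, η * q ≤ P t → ‖w t - W‖ ≤ ρ * W)
    (hmid : ∑ t with η' * q ≤ P t ∧ P t < η * q, P t ^ 2 ≤ (ε * q) ^ 2)
    (hwG : ∀ t, ‖w t‖ ≤ V * G t) (hG : ∑ t, G t ^ 6 ≤ T)
    (hT : q ^ 12 * η' ^ 2 * T ≤ τ₀ ^ 6)
    (hmain : c * (κ * q ^ 2) ≤ (∑ t with η * q ≤ P t, f t).re) :
    κ * q ^ 2 * W * (c - ρ - ε) - κ * V * τ₀ ≤ (∑ t, f t * w t).re := by
  classical
  have hPR : ∑ t, P t * R t ≤ q * q := sum_mul_le_of_sum_sq_le _ hq hq hP hR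
  have hsplit : ∑ t, f t * w t = W * (∑ t with η * q ≤ P t, f t) +
      ∑ t with η * q ≤ P t, f t * (w t - W) +
      ∑ t with η' * q ≤ P t ∧ P t < η * q, f t * w t + ∑ t with P t < η' * q, f t * w t := by
    rw [← sum_filter_add_sum_filter_not univ (fun t => η * q ≤ P t),
      ← sum_filter_add_sum_filter_not ({t | ¬ η * q ≤ P t} : Finset τ) (fun t => η' * q ≤ P t),
      filter_filter, filter_filter, mul_sum, ← sum_add_distrib, add_assoc]
    have e1 : ∀ t, (W : ℂ) * f t + f t * (w t - W) = f t * w t := fun t => by ring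
    simp only [e1, not_le]
    congr 2
    · refine sum_congr ?_ fun _ _ => rfl
      ext t
      simp only [mem_filter, mem_univ, true_and, and_comm]
    · refine sum_congr ?_ fun _ _ => rfl
      ext t
      simp only [mem_filter, mem_univ, true_and]
      refine ⟨fun h => h.2, fun h => ⟨h.trans_le (by gcongr), h⟩⟩
  have hB : ‖∑ t with η * q ≤ P t, f t * (w t - W)‖ ≤ κ * q ^ 2 * W * ρ := by
    refine (norm_sum_le _ _).trans ?_
    calc _ ≤ ∑ t with η * q ≤ P t, κ * (P t * R t) * (ρ * W) := by
          refine sum_le_sum fun t ht => ?_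
          rw [norm_mul]
          exact mul_le_mul (hf t) (hbig t (mem_filter.1 ht).2) (norm_nonneg _)
            (mul_nonneg hκ (mul_nonneg (hP0 t) (hR0 t)))
      _ ≤ ∑ t, κ * (P t * R t) * (ρ * W) :=
          sum_le_sum_of_subset_of_nonneg (filter_subset _ _) fun t _ _ =>
            mul_nonneg (mul_nonneg hκ (mul_nonneg (hP0 t) (hR0 t))) (by positivity)
      _ = κ * (∑ t, P t * R t) * (ρ * W) := by rw [← sum_mul, ← mul_sum]
      _ ≤ κ * (q * q) * (ρ * W) := by gcongr
      _ = _ := by ring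
  have hM : ‖∑ t with η' * q ≤ P t ∧ P t < η * q, f t * w t‖ ≤ κ * q ^ 2 * W * ε := by
    refine (norm_sum_le _ _).trans ?_
    calc _ ≤ ∑ t with η' * q ≤ P t ∧ P t < η * q, κ * (P t * R t) * W := by
          refine sum_le_sum fun t ht => ?_
          rw [norm_mul]
          exact mul_le_mul (hf t) (hw t) (norm_nonneg _)
            (mul_nonneg hκ (mul_nonneg (hP0 t) (hR0 t)))
      _ = κ * (∑ t with η' * q ≤ P t ∧ P t < η * q, P t * R t) * W := by
          rw [← sum_mul, ← mul_sum]
      _ ≤ κ * (ε * q * q) * W := by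
          gcongr
          refine sum_mul_le_of_sum_sq_le _ (by positivity) hq hmid (le_trans ?_ hR)
          exact sum_le_sum_of_subset_of_nonneg (filter_subset _ _) fun t _ _ => by positivity
      _ = _ := by ring
  have hS : ‖∑ t with P t < η' * q, f t * w t‖ ≤ κ * V * τ₀ := by
    refine (norm_sum_le _ _).trans ?_
    -- Hölder, with (η' q)² pulled out of the weight P².
    have hτ : ∑ t with P t < η' * q, P t * R t * G t ≤ τ₀ := by
      refine le_of_pow_le_pow_left₀ (by norm_num : (6 : ℕ) ≠ 0) hτ₀ ?_
      refine (sum_mul_mul_pow_six_le _ P R G).trans (le_trans ?_ hT)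
      have h1 : ∑ t with P t < η' * q, P t ^ 2 ≤ q ^ 2 :=
        (sum_le_sum_of_subset_of_nonneg (filter_subset _ _) fun t _ _ => by positivity).trans hP
      have h2 : ∑ t with P t < η' * q, R t ^ 2 ≤ q ^ 2 :=
        (sum_le_sum_of_subset_of_nonneg (filter_subset _ _) fun t _ _ => by positivity).trans hR
      have h3 : ∑ t with P t < η' * q, P t ^ 2 * G t ^ 6 ≤ (η' * q) ^ 2 * T := by
        calc _ ≤ ∑ t with P t < η' * q, (η' * q) ^ 2 * G t ^ 6 := by
              refine sum_le_sum fun t ht => ?_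
              have := hG0 t
              gcongr
              · exact hP0 t
              · exact (mem_filter.1 ht).2.le
          _ = (η' * q) ^ 2 * ∑ t with P t < η' * q, G t ^ 6 := by rw [mul_sum]
          _ ≤ _ := by
              gcongr
              exact (sum_le_sum_of_subset_of_nonneg (filter_subset _ _)
                fun t _ _ => by have := hG0 t; positivity).trans hG
      calc _ ≤ (q ^ 2) ^ 2 * ((η' * q) ^ 2 * T) * (q ^ 2) ^ 3 := by
            have hT0 : 0 ≤ T := (sum_nonneg fun t _ => by have := hG0 t; positivity).trans hG
            gcongr
        _ = _ := by ring
    calc _ ≤ ∑ t with P t < η' * q, κ * V * (P t * R t * G t) := by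
          refine sum_le_sum fun t _ => ?_
          rw [norm_mul]
          refine (mul_le_mul (hf t) (hwG t) (norm_nonneg _)
            (mul_nonneg hκ (mul_nonneg (hP0 t) (hR0 t)))).trans (le_of_eq (by ring))
      _ = κ * V * ∑ t with P t < η' * q, P t * R t * G t := by rw [← mul_sum]
      _ ≤ _ := by gcongr
  rw [hsplit, Complex.add_re, Complex.add_re, Complex.add_re, Complex.re_ofReal_mul]
  have b1 := (Complex.abs_re_le_norm _).trans hB
  have b2 := (Complex.abs_re_le_norm _).trans hM
  have b3 := (Complex.abs_re_le_norm _).trans hS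
  have b4 := mul_le_mul_of_nonneg_left hmain hW
  rw [abs_le] at b1 b2 b3
  nlinarith [b1.1, b2.1, b3.1]

/-! ### The solution count as a sum over frequencies -/

theorem norm_stdAddChar_intCast_mul_sub_one_le {Q : ℕ} [NeZero Q] (n : ℤ) (x : ZMod Q) :
    ‖ZMod.stdAddChar ((n : ZMod Q) * x) - 1‖ ≤ n.natAbs * ‖ZMod.stdAddChar x - 1‖ := by
  have hnat : ∀ k : ℕ, ‖ZMod.stdAddChar ((k : ZMod Q) * x) - 1‖ ≤
      k * ‖ZMod.stdAddChar x - 1‖ := by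
    intro k
    induction k with
    | zero => simp
    | succ k ih =>
      have : ZMod.stdAddChar (((k + 1 : ℕ) : ZMod Q) * x) - 1 =
          ZMod.stdAddChar ((k : ZMod Q) * x) * (ZMod.stdAddChar x - 1) +
            (ZMod.stdAddChar ((k : ZMod Q) * x) - 1) := by
        push_cast
        rw [add_mul, one_mul, AddChar.map_add_eq_mul]
        ring
      rw [this]
      refine (norm_add_le _ _).trans ?_
      rw [norm_mul, norm_stdAddChar, one_mul]
      push_cast
      linarith
  obtain ⟨k, rfl | rfl⟩ := n.eq_nat_or_neg
  · simpa using hnat k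
  · have : ZMod.stdAddChar (((-(k : ℤ) : ℤ) : ZMod Q) * x) - 1 =
        (starRingEnd ℂ) (ZMod.stdAddChar ((k : ZMod Q) * x) - 1) := by
      push_cast
      rw [neg_mul, AddChar.map_neg_eq_conj, map_sub, map_one]
    rw [this, RCLike.norm_conj]
    simpa using hnat k

theorem stdAddChar_sum {Q : ℕ} [NeZero Q] {ι : Type*} (T : Finset ι) (f : ι → ZMod Q) :
    ZMod.stdAddChar (∑ i ∈ T, f i) = ∏ i ∈ T, ZMod.stdAddChar (f i) := by
  classical
  induction T using Finset.induction_on with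
  | empty => simp
  | insert j T hj ih => rw [Finset.sum_insert hj, Finset.prod_insert hj, AddChar.map_add_eq_mul, ih]

open Finset in
theorem norm_prod_sub_pow_le {ι : Type*} [DecidableEq ι] (T : Finset ι) {z : ι → ℂ} {d ρ : ℝ}
    (hd : 0 ≤ d) (hz : ∀ i ∈ T, ‖z i‖ ≤ d) (hzd : ∀ i ∈ T, ‖z i - d‖ ≤ ρ * d) :
    ‖∏ i ∈ T, z i - (d : ℂ) ^ #T‖ ≤ #T * ρ * d ^ #T := by
  induction T using Finset.induction_on with
  | empty => simp
  | insert j T hj ih =>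
    have ih' := ih (fun i hi => hz i (mem_insert_of_mem hi))
      fun i hi => hzd i (mem_insert_of_mem hi)
    rw [prod_insert hj, card_insert_of_notMem hj]
    have : z j * ∏ i ∈ T, z i - (d : ℂ) ^ (#T + 1) =
        z j * (∏ i ∈ T, z i - (d : ℂ) ^ #T) + (z j - d) * (d : ℂ) ^ #T := by ring
    rw [this]
    refine (norm_add_le _ _).trans ?_
    rw [norm_mul, norm_mul, norm_pow, Complex.norm_real, Real.norm_of_nonneg hd]
    calc _ ≤ d * (#T * ρ * d ^ #T) + ρ * d * d ^ #T := by
          gcongr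
          · exact hz j (mem_insert_self _ _)
          · exact hzd j (mem_insert_self _ _)
      _ = _ := by push_cast; ring

open Finset in
-- Orthogonality of characters detects the equation modulo Q; `hsmall` rules out wrap-around.
theorem mul_solutionCount_eq_sum {s t Q : ℕ} [NeZero Q] (a : Fin s → ℤ) (b : Fin t → ℤ)
    (X : Fin s → Finset ℕ) (Y : Fin t → Finset ℕ)
    (hsmall : ∀ x : Fin s → ℕ, (∀ i, x i ∈ X i) → ∀ y : Fin t → ℕ, (∀ j, y j ∈ Y j) →
      |∑ i, a i * (x i : ℤ) - ∑ j, b j * (y j : ℤ) ^ 2| < Q) :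
    (Q : ℂ) * solutionCount a b X Y = ∑ ξ : ZMod Q,
      (∏ i, ∑ x ∈ X i, ZMod.stdAddChar (ξ * ((a i : ZMod Q) * (x : ZMod Q)))) *
      ∏ j, ∑ y ∈ Y j, ZMod.stdAddChar (ξ * (((-b j : ℤ) : ZMod Q) * (y : ZMod Q) ^ 2)) := by
  have hexp : ∀ ξ : ZMod Q,
      (∏ i, ∑ x ∈ X i, ZMod.stdAddChar (ξ * ((a i : ZMod Q) * (x : ZMod Q)))) *
      ∏ j, ∑ y ∈ Y j, ZMod.stdAddChar (ξ * (((-b j : ℤ) : ZMod Q) * (y : ZMod Q) ^ 2)) =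
      ∑ p ∈ Fintype.piFinset X ×ˢ Fintype.piFinset Y, ZMod.stdAddChar
        (ξ * ((∑ i, a i * (p.1 i : ℤ) - ∑ j, b j * (p.2 j : ℤ) ^ 2 : ℤ) : ZMod Q)) := by
    intro ξ
    rw [prod_univ_sum, prod_univ_sum, sum_mul_sum, sum_product]
    refine sum_congr rfl fun x _ => sum_congr rfl fun y _ => ?_
    rw [← stdAddChar_sum, ← stdAddChar_sum, ← AddChar.map_add_eq_mul,
      ← mul_sum, ← mul_sum, ← mul_add]
    congr 2
    push_cast
    rw [sub_eq_add_neg, ← sum_neg_distrib]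
    congr 1
    exact sum_congr rfl fun j _ => by ring
  rw [sum_congr rfl fun ξ _ => hexp ξ, sum_comm]
  simp only [sum_stdAddChar_mul]
  rw [← sum_filter, sum_const, nsmul_eq_mul, mul_comm, solutionCount]
  congr 3
  refine filter_congr fun p hp => ?_
  rw [mem_product, Fintype.mem_piFinset, Fintype.mem_piFinset] at hp
  rw [ZMod.intCast_zmod_eq_zero_iff_dvd, ← sub_eq_zero]
  refine ⟨fun h => by rw [h]; exact dvd_zero _, fun h => ?_⟩
  exact Int.eq_zero_of_abs_lt_dvd h (hsmall p.1 hp.1 p.2 hp.2)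

open Finset in
-- The coefficients on S sum to zero, so x_i may be replaced by x_i − u for i ∈ S. A modulus of
-- order M² therefore suffices wherever the interval lies.
theorem abs_sum_sub_sum_sq_le {s t : ℕ} (a : Fin s → ℤ) (b : Fin t → ℤ) (S : Finset (Fin s))
    (hS : ∑ i ∈ S, a i = 0) {u : ℕ} {M : ℝ} (hM : 1 ≤ M) {A D : Finset ℕ}
    (hA : ∀ x ∈ A, (u : ℝ) < x ∧ (x : ℝ) ≤ u + M ^ 2) (hD : ∀ y ∈ D, (y : ℝ) ≤ M)
    {x : Fin s → ℕ} (hx : ∀ i, x i ∈ if i ∈ S then A else D) {y : Fin t → ℕ}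
    (hy : ∀ j, y j ∈ D) :
    ((|∑ i, a i * (x i : ℤ) - ∑ j, b j * (y j : ℤ) ^ 2| : ℤ) : ℝ) ≤
      (∑ i, (a i).natAbs + ∑ j, (b j).natAbs : ℕ) * M ^ 2 := by
  set x' : Fin s → ℤ := fun i => if i ∈ S then (x i : ℤ) - u else x i with hx'
  have hshift : ∑ i, a i * (x i : ℤ) = ∑ i, a i * x' i := by
    have : ∀ i, a i * x' i = a i * (x i : ℤ) - (if i ∈ S then a i else 0) * u := by
      intro i
      simp only [hx']
      split_ifs <;> ring
    simp only [this]
    rw [sum_sub_distrib, ← sum_mul, sum_ite_mem, univ_inter, hS, zero_mul, sub_zero]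
  have hMsq : M ≤ M ^ 2 := by nlinarith
  have hx'M : ∀ i, |(x' i : ℝ)| ≤ M ^ 2 := by
    intro i
    have := hx i
    simp only [hx']
    by_cases hi : i ∈ S
    · simp only [hi, if_true] at this ⊢
      have := hA _ this
      push_cast
      rw [abs_le]
      constructor <;> linarith [sq_nonneg M]
    · simp only [hi, if_false] at this ⊢
      have := hD _ this
      push_cast
      rw [abs_of_nonneg (Nat.cast_nonneg _)]
      linarith
  have hyM : ∀ j, |((y j : ℝ)) ^ 2| ≤ M ^ 2 := by
    intro j
    have := hD _ (hy j)
    rw [abs_of_nonneg (by positivity)]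
    gcongr
  have hnat : ∀ n : ℤ, |(n : ℝ)| = n.natAbs := fun n => by
    rw [Nat.cast_natAbs, Int.cast_abs]
  rw [hshift]
  push_cast
  refine (abs_sub _ _).trans ?_
  rw [add_mul, sum_mul, sum_mul]
  refine add_le_add ((abs_sum_le_sum_abs _ _).trans (sum_le_sum fun i _ => ?_))
    ((abs_sum_le_sum_abs _ _).trans (sum_le_sum fun j _ => ?_))
  · rw [abs_mul, hnat]
    gcongr
    exact hx'M i
  · rw [abs_mul, hnat]
    gcongr
    exact hyM j

/-- The sum of the absolute values of the coefficients, plus three. -/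
def coefficientBound {s t : ℕ} (a : Fin s → ℤ) (b : Fin t → ℤ) : ℕ :=
  ∑ i, (a i).natAbs + ∑ j, (b j).natAbs + 3

theorem natAbs_left_le_coefficientBound {s t : ℕ} (a : Fin s → ℤ) (b : Fin t → ℤ) (i : Fin s) :
    (a i).natAbs ≤ coefficientBound a b := by
  have := Finset.single_le_sum (f := fun i => (a i).natAbs) (fun _ _ => Nat.zero_le _)
    (Finset.mem_univ i)
  unfold coefficientBound
  omega

theorem natAbs_right_le_coefficientBound {s t : ℕ} (a : Fin s → ℤ) (b : Fin t → ℤ) (j : Fin t) :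
    (b j).natAbs ≤ coefficientBound a b := by
  have := Finset.single_le_sum (f := fun j => (b j).natAbs) (fun _ _ => Nat.zero_le _)
    (Finset.mem_univ j)
  unfold coefficientBound
  omega

theorem intCast_zmod_ne_zero {Q : ℕ} {n : ℤ} (hn : n ≠ 0) (h : n.natAbs < Q) :
    (n : ZMod Q) ≠ 0 := by
  rw [Ne, ZMod.intCast_zmod_eq_zero_iff_dvd]
  intro hd
  have := Nat.le_of_dvd (Int.natAbs_pos.2 hn) (Int.natCast_dvd.1 hd)
  omega

set_option maxHeartbeats 1000000 in
open Finset in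
-- The order of the quantifiers matters: ε, η₀ and ρ precede the density β of D, and only the
-- small-spectrum threshold θ and the final constant depend on β. This permits choosing η' after the
-- Bohr set determined by η.
theorem exists_le_solutionCount_of_spectrum {s t : ℕ} (ht : 1 ≤ t) (a : Fin s → ℤ) (b : Fin t → ℤ)
    (ha : ∀ i, a i ≠ 0) (hb : ∀ j, b j ≠ 0) (S : Finset (Fin s)) (hSc : 2 ≤ #S)
    (hS : ∑ i ∈ S, a i = 0) {i₀ : Fin s} (hi₀ : i₀ ∈ S) {δ : ℝ} (hδ : 0 < δ) :
    ∃ ε : ℝ, 0 < ε ∧ ∃ η₀ : ℝ, 0 < η₀ ∧ ∃ ρ : ℝ, 0 < ρ ∧ ∀ β : ℝ, 0 < β → ∃ θ : ℝ, 0 < θ ∧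
      ∃ c : ℝ, 0 < c ∧ ∀ (M : ℝ), 1 ≤ M → ∀ (Q : ℕ) [Fact Q.Prime],
      (coefficientBound a b : ℝ) * M ^ 2 < Q → (Q : ℝ) ≤ 4 * coefficientBound a b * M ^ 2 →
      ∀ (u : ℕ) (A : Finset ℕ), (∀ x ∈ A, (u : ℝ) < x ∧ (x : ℝ) ≤ u + M ^ 2) →
      δ * M ^ 2 ≤ #A → ∀ η η' : ℝ, 0 ≤ η' → η' ≤ θ → η' ≤ η → η ≤ η₀ →
      ∑ ξ : ZMod Q with
        η' * Q ≤ ‖indicatorDFT (A.image (Nat.cast : ℕ → ZMod Q)) (a i₀ * ξ)‖ ∧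
        ‖indicatorDFT (A.image (Nat.cast : ℕ → ZMod Q)) (a i₀ * ξ)‖ < η * Q,
        ‖indicatorDFT (A.image (Nat.cast : ℕ → ZMod Q)) (a i₀ * ξ)‖ ^ 2 ≤ (ε * Q) ^ 2 →
      ∀ D ⊆ Icc 1 ⌊M⌋₊, β * ⌊M⌋₊ ≤ #D →
      (∀ y ∈ D, ∀ ξ : ZMod Q,
        η * Q ≤ ‖indicatorDFT (A.image (Nat.cast : ℕ → ZMod Q)) (a i₀ * ξ)‖ →
        ‖ZMod.stdAddChar (ξ * (y : ZMod Q)) - 1‖ ≤ ρ ∧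
        ‖ZMod.stdAddChar (ξ * (y : ZMod Q) ^ 2) - 1‖ ≤ ρ) →
      c * M ^ (#S + s + t - 2) ≤
        solutionCount a b (fun i => if i ∈ S then A else D) (fun _ => D) := by
  set Λ := coefficientBound a b with hΛ
  have hΛ3 : 3 ≤ Λ := by rw [hΛ, coefficientBound]; omega
  have hΛ0 : (0 : ℝ) < Λ := by exact_mod_cast (by omega : 0 < Λ)
  obtain ⟨c₁, hc₁, η₀, hη₀, hmain⟩ := exists_le_re_sum_large_spectrum #S hSc
    (show 0 < δ / (4 * Λ) by positivity)
  set K : Finset (Fin s ⊕ Fin t) := Sᶜ.disjSum univ with hK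
  set m := #K with hm
  have hmval : m = (s - #S) + t := by
    rw [hm, hK, card_disjSum, card_compl, Fintype.card_fin, card_univ, Fintype.card_fin]
  have hSs : #S ≤ s := by simpa using card_le_univ S
  -- On the large spectrum each of the m exponential sums over D is within a proportion Λρ of |D|,
  -- so their product is within a proportion mΛρ = c₁/8 of |D|^m.
  set ρ := c₁ / (8 * m * Λ) with hρ
  have hm0 : (0 : ℝ) < m := by exact_mod_cast (by omega : 0 < m)
  have hρ0 : 0 < ρ := by positivity
  refine ⟨c₁ / 8, by positivity, η₀, hη₀, ρ, hρ0, fun β hβ => ?_⟩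
  set σ := c₁ / 8 * β ^ m with hσ
  have hσ0 : 0 < σ := by positivity
  -- Here 3072 = 16 · 192, from Q ≤ 16ΛX² and the sixth moment 192QX⁴. As |D| ≥ βX, the choice of σ
  -- makes the small spectrum cost at most c₁/8. Three errors of c₁/8 leave more than c₁/2.
  refine ⟨σ ^ 3 / (3072 * Λ), by positivity, c₁ / 2 * (β / 2) ^ m, by positivity, ?_⟩
  intro M hM Q hQ hQlow hQup u A hA hAcard η η' hη'0 hη'θ hη'η hηη₀ hmid D hD hDcard hBohr
  set X := ⌊M⌋₊ with hX
  have hQ0 : (0 : ℝ) < Q := by exact_mod_cast hQ.out.pos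
  have hM0 : 0 < M := by linarith
  have hXM : (X : ℝ) ≤ M := Nat.floor_le hM0.le
  have hX1 : 1 ≤ X := Nat.one_le_floor_iff M |>.2 hM
  have hX1' : (1 : ℝ) ≤ X := by exact_mod_cast hX1
  have hMX : M ≤ 2 * X := by have := Nat.lt_floor_add_one M; rw [← hX] at this; linarith
  have hM2 : 1 ≤ M ^ 2 := one_le_pow₀ hM
  have hΛQ : Λ < Q := by
    have : (Λ : ℝ) < Q := lt_of_le_of_lt (by nlinarith) hQlow
    exact_mod_cast this
  have haQ : ∀ i, (a i : ZMod Q) ≠ 0 := fun i => intCast_zmod_ne_zero (ha i)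
    ((natAbs_left_le_coefficientBound a b i).trans_lt hΛQ)
  have hbQ : ∀ j, ((-b j : ℤ) : ZMod Q) ≠ 0 := fun j => intCast_zmod_ne_zero
    (neg_ne_zero.2 (hb j))
    (by rw [Int.natAbs_neg]; exact (natAbs_right_le_coefficientBound a b j).trans_lt hΛQ)
  have hDM : ∀ y ∈ D, (y : ℝ) ≤ M := fun y hy =>
    le_trans (by exact_mod_cast (mem_Icc.1 (hD hy)).2) hXM
  have hDX : #D ≤ X := by simpa using card_le_card hD
  have hcount := mul_solutionCount_eq_sum (Q := Q) a b (fun i => if i ∈ S then A else D)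
    (fun _ => D) (fun x hx y hy => by
      have h1 := abs_sum_sub_sum_sq_le a b S hS hM hA hDM hx hy
      have h2 : ((∑ i, (a i).natAbs + ∑ j, (b j).natAbs : ℕ) : ℝ) * M ^ 2 ≤ Λ * M ^ 2 := by
        gcongr
        rw [hΛ, coefficientBound]
        omega
      have h3 := (h1.trans h2).trans_lt hQlow
      exact_mod_cast h3)
  set A' := A.image (Nat.cast : ℕ → ZMod Q) with hA'
  have hinjA : Set.InjOn (Nat.cast : ℕ → ZMod Q) A := by
    intro x hx y hy hxy
    have h1 := hA x hx
    have h2 := hA y hy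
    have h3 : ((x : ℤ) - y : ℤ) = 0 := by
      refine Int.eq_zero_of_abs_lt_dvd (m := Q) ?_ ?_
      · rw [← ZMod.intCast_zmod_eq_zero_iff_dvd]
        push_cast
        rw [hxy, sub_self]
      · have : |(x : ℝ) - y| < Q := by
          have hlt : M ^ 2 < Q := lt_of_le_of_lt (by
            have : (3 : ℝ) ≤ Λ := by exact_mod_cast hΛ3
            nlinarith) hQlow
          rw [abs_lt]
          constructor <;> linarith
        exact_mod_cast this
    omega
  have hA'card : δ / (4 * Λ) * Q ≤ #A' := by
    rw [hA', card_image_of_injOn hinjA]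
    refine le_trans ?_ hAcard
    rw [div_mul_eq_mul_div, div_le_iff₀ (by positivity)]
    calc δ * Q ≤ δ * (4 * Λ * M ^ 2) := by gcongr
      _ = _ := by ring
  have hQ2 : Q ≠ 2 := by omega
  have hmain' := hmain Q hQ2 S (fun i => (a i : ZMod Q)) rfl haQ
    (by exact_mod_cast congrArg (Int.cast : ℤ → ZMod Q) hS) i₀ hi₀ A' hA'card η
    (hη'0.trans hη'η) hηη₀
  set z : Fin s ⊕ Fin t → ZMod Q → ℂ := fun k ξ => Sum.elim
    (fun i => ∑ x ∈ D, ZMod.stdAddChar (ξ * ((a i : ZMod Q) * (x : ZMod Q))))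
    (fun j => ∑ y ∈ D, ZMod.stdAddChar (ξ * (((-b j : ℤ) : ZMod Q) * (y : ZMod Q) ^ 2))) k with hz
  set f : ZMod Q → ℂ := fun ξ => ∏ i ∈ S, indicatorDFT A' (a i * ξ) with hf
  set w : ZMod Q → ℂ := fun ξ => ∏ k ∈ K, z k ξ with hw
  have hfw : ∀ ξ : ZMod Q,
      (∏ i, ∑ x ∈ (if i ∈ S then A else D),
        ZMod.stdAddChar (ξ * ((a i : ZMod Q) * (x : ZMod Q)))) *
      ∏ j, ∑ y ∈ D, ZMod.stdAddChar (ξ * (((-b j : ℤ) : ZMod Q) * (y : ZMod Q) ^ 2)) =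
      f ξ * w ξ := by
    intro ξ
    simp only [hf, hw, hK, prod_disjSum, hz, Sum.elim_inl, Sum.elim_inr]
    rw [← prod_mul_prod_compl S, mul_assoc]
    congr 1
    · refine prod_congr rfl fun i hi => ?_
      rw [if_pos hi, indicatorDFT, hA', sum_image hinjA]
      exact sum_congr rfl fun x _ => by congr 1; ring
    · congr 1
      refine prod_congr rfl fun i hi => ?_
      rw [if_neg (mem_compl.1 hi)]
  rw [sum_congr rfl fun ξ _ => hfw ξ] at hcount
  have hzle : ∀ k ξ, ‖z k ξ‖ ≤ #D := by
    rintro (i | j) ξ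
    · exact norm_sum_stdAddChar_le _ _
    · exact norm_sum_stdAddChar_le _ _
  have hψ : ∀ (n : ℤ) (x : ZMod Q), n.natAbs ≤ Λ → ‖ZMod.stdAddChar x - 1‖ ≤ ρ →
      ‖ZMod.stdAddChar ((n : ZMod Q) * x) - 1‖ ≤ Λ * ρ := by
    intro n x hn hx
    refine (norm_stdAddChar_intCast_mul_sub_one_le n x).trans ?_
    gcongr
  have hsumclose : ∀ g : ℕ → ZMod Q, (∀ y ∈ D, ‖ZMod.stdAddChar (g y) - 1‖ ≤ Λ * ρ) →
      ‖∑ y ∈ D, ZMod.stdAddChar (g y) - ((#D : ℝ) : ℂ)‖ ≤ Λ * ρ * #D := by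
    intro g hg
    have : ∑ y ∈ D, ZMod.stdAddChar (g y) - ((#D : ℝ) : ℂ) =
        ∑ y ∈ D, (ZMod.stdAddChar (g y) - 1) := by
      rw [sum_sub_distrib]
      simp
    rw [this]
    refine (norm_sum_le _ _).trans ((sum_le_sum hg).trans (le_of_eq ?_))
    rw [sum_const, nsmul_eq_mul, mul_comm]
  have hbig : ∀ ξ, η * Q ≤ ‖indicatorDFT A' (a i₀ * ξ)‖ →
      ‖w ξ - (((#D : ℝ) ^ m : ℝ) : ℂ)‖ ≤ c₁ / 8 * (#D : ℝ) ^ m := by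
    intro ξ hξ
    have h1 := norm_prod_sub_pow_le (ρ := Λ * ρ) K (z := fun k => z k ξ)
      (Nat.cast_nonneg #D) (fun k _ => hzle k ξ) (by
        rintro (i | j) _
        · refine hsumclose _ fun y hy => ?_
          rw [mul_left_comm]
          exact hψ _ _ (natAbs_left_le_coefficientBound a b i) (hBohr y hy ξ hξ).1
        · refine hsumclose _ fun y hy => ?_
          rw [mul_left_comm]
          exact hψ _ _ (by rw [Int.natAbs_neg]; exact natAbs_right_le_coefficientBound a b j)
            (hBohr y hy ξ hξ).2)
    rw [Complex.ofReal_pow]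
    refine h1.trans (le_of_eq ?_)
    rw [← hm, hρ]
    field_simp
  obtain ⟨i₁, hi₁, h01⟩ : ∃ i₁ ∈ S, i₀ ≠ i₁ := by
    obtain ⟨i₁, h1, h2⟩ := exists_mem_ne (by omega : 1 < #S) i₀
    exact ⟨i₁, h1, h2.symm⟩
  set j₀ : Fin t := ⟨0, ht⟩
  have hj₀K : Sum.inr j₀ ∈ K := by simp [hK]
  have hXpow : (X : ℝ) ^ 2 ≤ M ^ 2 := by gcongr
  have hres := le_re_sum_mul_of_spectrum_split (f := f) (w := w)
    (P := fun ξ => ‖indicatorDFT A' (a i₀ * ξ)‖) (R := fun ξ => ‖indicatorDFT A' (a i₁ * ξ)‖)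
    (G := fun ξ => ‖z (Sum.inr j₀) ξ‖) (q := Q) (κ := (Q : ℝ) ^ (#S - 2)) (W := (#D : ℝ) ^ m)
    (V := (X : ℝ) ^ (m - 1)) (T := Q * (192 * X ^ 4)) (τ₀ := (Q : ℝ) ^ 2 * X * σ) (c := c₁)
    (ρ := c₁ / 8) (ε := c₁ / 8) (η := η) (η' := η') hQ0.le (by positivity) (by positivity)
    (by positivity) (by positivity) (by positivity) (by positivity) hη'η
    (fun _ => norm_nonneg _) (fun _ => norm_nonneg _) (fun _ => norm_nonneg _)
    (sum_norm_sq_indicatorDFT_le A' (haQ i₀)) (sum_norm_sq_indicatorDFT_le A' (haQ i₁))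
    (fun ξ => by
      refine (norm_prod_le_mul_mul_pow (fun i => norm_indicatorDFT_le A' (a i * ξ))
        hi₀ hi₁ h01).trans (le_of_eq (mul_comm _ _)))
    (fun ξ => by
      rw [hw, norm_prod, hm, ← prod_const]
      exact prod_le_prod (fun _ _ => norm_nonneg _) fun k _ => hzle k ξ)
    hbig hmid
    (fun ξ => by
      simp only [hw]
      rw [← mul_prod_erase K _ hj₀K, norm_mul, mul_comm]
      gcongr
      rw [norm_prod, hm, ← card_erase_of_mem hj₀K, ← prod_const]
      exact prod_le_prod (fun _ _ => norm_nonneg _) fun k _ =>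
        (hzle k ξ).trans (by exact_mod_cast hDX))
    (sum_norm_pow_six_sq_le hD (by
      have : (3 * X ^ 2 : ℝ) < Q := lt_of_le_of_lt (by
        have : (3 : ℝ) ≤ Λ := by exact_mod_cast hΛ3
        exact mul_le_mul this hXpow (by positivity) hΛ0.le) hQlow
      exact_mod_cast this) (hbQ j₀))
    (by
      have hη2 : η' ^ 2 * (3072 * Λ) ≤ σ ^ 6 := by
        calc η' ^ 2 * (3072 * Λ) ≤ (σ ^ 3 / (3072 * Λ)) ^ 2 * (3072 * Λ) := by gcongr
          _ = σ ^ 6 / (3072 * Λ) := by field_simp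
          _ ≤ σ ^ 6 := div_le_self (by positivity) (by
              have : (3 : ℝ) ≤ Λ := by exact_mod_cast hΛ3
              linarith)
      have hQX : (Q : ℝ) ≤ 16 * Λ * X ^ 2 := by
        calc (Q : ℝ) ≤ 4 * Λ * M ^ 2 := hQup
          _ ≤ 4 * Λ * (2 * X) ^ 2 := by gcongr
          _ = _ := by ring
      calc (Q : ℝ) ^ 12 * η' ^ 2 * (Q * (192 * X ^ 4))
          ≤ (Q : ℝ) ^ 12 * η' ^ 2 * ((16 * Λ * X ^ 2) * (192 * X ^ 4)) := by gcongr
        _ = (Q : ℝ) ^ 12 * X ^ 6 * (η' ^ 2 * (3072 * Λ)) := by ring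
        _ ≤ (Q : ℝ) ^ 12 * X ^ 6 * σ ^ 6 := by gcongr
        _ = _ := by ring)
    (by
      refine le_trans (le_of_eq ?_) hmain'
      rw [← pow_add, Nat.sub_add_cancel hSc])
  rw [← hcount, ← Complex.ofReal_natCast, ← Complex.ofReal_natCast, ← Complex.ofReal_mul,
    Complex.ofReal_re] at hres
  have hDpow : (β * X) ^ m ≤ (#D : ℝ) ^ m := by gcongr
  have hVτ : (Q : ℝ) ^ (#S - 2) * X ^ (m - 1) * ((Q : ℝ) ^ 2 * X * σ) ≤
      (Q : ℝ) ^ (#S - 2) * Q ^ 2 * (#D : ℝ) ^ m * (c₁ / 8) := by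
    have hXm : (X : ℝ) ^ m = X ^ (m - 1) * X := by
      rw [← pow_succ, Nat.sub_add_cancel (by omega)]
    calc (Q : ℝ) ^ (#S - 2) * X ^ (m - 1) * ((Q : ℝ) ^ 2 * X * σ)
        = (Q : ℝ) ^ (#S - 2) * Q ^ 2 * (β * X) ^ m * (c₁ / 8) := by
          rw [hσ, mul_pow, hXm]; ring
      _ ≤ _ := by gcongr
  have hfin : (Q : ℝ) * (Q ^ (#S - 1) * (#D : ℝ) ^ m * (c₁ / 2)) ≤
      Q * solutionCount a b (fun i => if i ∈ S then A else D) (fun _ => D) := by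
    refine le_trans ?_ hres
    have e : (Q : ℝ) * Q ^ (#S - 1) = Q ^ (#S - 2) * Q ^ 2 := by
      rw [← pow_succ', ← pow_add]
      congr 1
      omega
    have hpos : 0 ≤ (Q : ℝ) ^ (#S - 2) * Q ^ 2 * (#D : ℝ) ^ m * c₁ := by positivity
    calc (Q : ℝ) * (Q ^ (#S - 1) * (#D : ℝ) ^ m * (c₁ / 2))
        = (Q : ℝ) ^ (#S - 2) * Q ^ 2 * (#D : ℝ) ^ m * (c₁ / 2) := by
          rw [← e]; ring
      _ ≤ _ := by linarith
  refine le_trans ?_ (le_of_mul_le_mul_left hfin hQ0)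
  have hMQ : M ^ 2 ≤ Q := le_trans (by
    have : (3 : ℝ) ≤ Λ := by exact_mod_cast hΛ3
    nlinarith) hQlow.le
  have hexp : #S + s + t - 2 = 2 * (#S - 1) + m := by omega
  calc c₁ / 2 * (β / 2) ^ m * M ^ (#S + s + t - 2)
      = (M ^ 2) ^ (#S - 1) * (β * (M / 2)) ^ m * (c₁ / 2) := by
        rw [hexp, pow_add, pow_mul, mul_pow, div_pow, div_pow]; ring
    _ ≤ Q ^ (#S - 1) * (β * X) ^ m * (c₁ / 2) := by
        gcongr
        linarith
    _ ≤ _ := by gcongr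

/-! ### Choice of thresholds and a Bohr set common to several classes -/

open Finset in
/-- Pigeonholing the energy `∑ P²` over the levels of a decreasing sequence of heights. -/
theorem exists_level_sum_sq_le {τ : Type*} (T : Finset τ) (P : τ → ℝ) {η : ℕ → ℝ}
    (hη : ∀ j, η (j + 1) ≤ η j) {J : ℕ} (hJ : 0 < J) :
    ∃ j < J, J * ∑ t ∈ T with η (j + 1) ≤ P t ∧ P t < η j, P t ^ 2 ≤ ∑ t ∈ T, P t ^ 2 := by
  by_contra! h
  have hsum : ∑ j ∈ range J, ∑ t ∈ T with η (j + 1) ≤ P t ∧ P t < η j, P t ^ 2 ≤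
      ∑ t ∈ T, P t ^ 2 := by
    simp only [sum_filter]
    rw [sum_comm]
    refine sum_le_sum fun t _ => ?_
    have htel : ∀ j, (if η (j + 1) ≤ P t ∧ P t < η j then P t ^ 2 else 0) =
        (if P t < η j then P t ^ 2 else 0) - (if P t < η (j + 1) then P t ^ 2 else 0) := by
      intro j
      have := hη j
      by_cases h1 : P t < η (j + 1)
      · simp [h1, h1.trans_le this, not_le.2 h1]
      · simp [h1, not_lt.1 h1]
    rw [sum_congr rfl fun j _ => htel j, sum_range_sub']
    split_ifs <;> nlinarith [sq_nonneg (P t)]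
  have hlt := sum_lt_sum_of_nonempty (nonempty_range_iff.2 hJ.ne') fun j hj => h j (mem_range.1 hj)
  rw [sum_const, card_range, nsmul_eq_mul, ← mul_sum] at hlt
  have hJ' : (0 : ℝ) < J := by exact_mod_cast hJ
  exact absurd hsum (not_le.2 (lt_of_mul_lt_mul_left hlt hJ'.le))

open Finset in
theorem card_large_spectrum_le {Q : ℕ} [Fact Q.Prime] (A : Finset (ZMod Q)) {c : ZMod Q}
    (hc : c ≠ 0) {η : ℝ} (hη : 0 < η) :
    #{ξ : ZMod Q | η * Q ≤ ‖indicatorDFT A (c * ξ)‖} ≤ ⌈1 / η ^ 2⌉₊ := by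
  have hQ : (0 : ℝ) < Q := by exact_mod_cast (Fact.out : Q.Prime).pos
  have h : (#{ξ : ZMod Q | η * Q ≤ ‖indicatorDFT A (c * ξ)‖} : ℝ) * (η * Q) ^ 2 ≤ (Q : ℝ) ^ 2 := by
    refine le_trans ?_ (sum_norm_sq_indicatorDFT_le A hc)
    rw [← nsmul_eq_mul, ← sum_const]
    refine (sum_le_sum fun ξ hξ => ?_).trans
      (sum_le_sum_of_subset_of_nonneg (filter_subset _ _) fun ξ _ _ => by positivity)
    have := (mem_filter.1 hξ).2
    gcongr
  have h' : (#{ξ : ZMod Q | η * Q ≤ ‖indicatorDFT A (c * ξ)‖} : ℝ) ≤ 1 / η ^ 2 := by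
    rw [le_div_iff₀ (by positivity)]
    refine le_of_mul_le_mul_right ?_ (show (0 : ℝ) < Q ^ 2 by positivity)
    rw [one_mul, mul_assoc, ← mul_pow]
    exact h
  exact_mod_cast h'.trans (Nat.le_ceil _)

theorem exists_prime_between {Λ : ℕ} (hΛ : 1 ≤ Λ) {M : ℝ} (hM : 1 ≤ M) :
    ∃ Q : ℕ, Q.Prime ∧ (Λ : ℝ) * M ^ 2 < Q ∧ (Q : ℝ) ≤ 4 * Λ * M ^ 2 := by
  have hΛ' : (1 : ℝ) ≤ Λ := by exact_mod_cast hΛ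
  have h1 : 1 ≤ (Λ : ℝ) * M ^ 2 := by nlinarith
  have hn : ⌈(Λ : ℝ) * M ^ 2⌉₊ ≠ 0 := (Nat.ceil_pos.2 (by linarith)).ne'
  obtain ⟨Q, hQ, hlo, hhi⟩ := Nat.exists_prime_lt_and_le_two_mul _ hn
  refine ⟨Q, hQ, lt_of_le_of_lt (Nat.le_ceil _) (by exact_mod_cast hlo), ?_⟩
  have h2 : (⌈(Λ : ℝ) * M ^ 2⌉₊ : ℝ) < Λ * M ^ 2 + 1 := Nat.ceil_lt_add_one (by linarith)
  have h3 : (Q : ℝ) ≤ 2 * ⌈(Λ : ℝ) * M ^ 2⌉₊ := by exact_mod_cast hhi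
  linarith

open Finset in
/-- For finitely many dense sets `A k` in intervals of length `M ^ 2` there is a dense set
`B ⊆ [M]` such that each of its dense subsets `D`, together with each `A k`, contains many
solutions of the equation. -/
theorem exists_common_bohr_set {s t : ℕ} (ht : 1 ≤ t) (a : Fin s → ℤ) (b : Fin t → ℤ)
    (ha : ∀ i, a i ≠ 0) (hb : ∀ j, b j ≠ 0) (S : Finset (Fin s)) (hSc : 2 ≤ #S)
    (hS : ∑ i ∈ S, a i = 0) {r : ℕ} (hr : 1 ≤ r) {δ : ℝ} (hδ : 0 < δ) :
    ∃ c : ℝ, 0 < c ∧ c ≤ 1 ∧ ∀ M : ℝ, 1 / c ≤ M → ∀ (κ : Finset (Fin r)) (u : Fin r → ℕ)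
      (A : Fin r → Finset ℕ),
      (∀ k ∈ κ, ∀ x ∈ A k, (u k : ℝ) < x ∧ (x : ℝ) ≤ u k + M ^ 2) →
      (∀ k ∈ κ, δ * M ^ 2 ≤ #(A k)) →
      ∃ B ⊆ Icc 1 ⌊M⌋₊, c * M ≤ #B ∧ ∀ k ∈ κ, ∀ D ⊆ B, #B ≤ r * #D →
        c * M ^ (#S + s + t - 2) ≤
          solutionCount a b (fun i => if i ∈ S then A k else D) (fun _ => D) := by
  classical
  obtain ⟨i₀, hi₀⟩ : S.Nonempty := card_pos.1 (by omega)
  obtain ⟨ε, hε, η₀, hη₀, ρ, hρ, hcore⟩ :=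
    exists_le_solutionCount_of_spectrum ht a b ha hb S hSc hS hi₀ hδ
  set Λ := coefficientBound a b with hΛ
  have hr0 : (0 : ℝ) < r := by exact_mod_cast hr
  -- Passage from one threshold to the next: η bounds the number of large frequencies, which fixes
  -- the Bohr density β, which fixes θ, and η' lies below all of these. It also serves as the
  -- constant in the conclusions, and 1/η' as the lower bound for M.
  have hstep : ∀ η : ℝ, ∃ η' : ℝ, 0 < η → 0 < η' ∧ η' ≤ η ∧ η' ≤ 1 ∧ (η ≤ η₀ →
      ∀ M : ℝ, 1 / η' ≤ M → ∀ (Q : ℕ) [Fact Q.Prime], (Λ : ℝ) * M ^ 2 < Q →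
      (Q : ℝ) ≤ 4 * Λ * M ^ 2 → ∀ (κ : Finset (Fin r)) (u : Fin r → ℕ) (A : Fin r → Finset ℕ),
      (∀ k ∈ κ, ∀ x ∈ A k, (u k : ℝ) < x ∧ (x : ℝ) ≤ u k + M ^ 2) →
      (∀ k ∈ κ, δ * M ^ 2 ≤ #(A k)) →
      (∀ k ∈ κ, ∑ ξ : ZMod Q with
        η' * Q ≤ ‖indicatorDFT ((A k).image (Nat.cast : ℕ → ZMod Q)) (a i₀ * ξ)‖ ∧
        ‖indicatorDFT ((A k).image (Nat.cast : ℕ → ZMod Q)) (a i₀ * ξ)‖ < η * Q,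
        ‖indicatorDFT ((A k).image (Nat.cast : ℕ → ZMod Q)) (a i₀ * ξ)‖ ^ 2 ≤ (ε * Q) ^ 2) →
      ∃ B ⊆ Icc 1 ⌊M⌋₊, η' * M ≤ #B ∧ ∀ k ∈ κ, ∀ D ⊆ B, #B ≤ r * #D →
        η' * M ^ (#S + s + t - 2) ≤
          solutionCount a b (fun i => if i ∈ S then A k else D) (fun _ => D)) := by
    intro η
    by_cases hη : 0 < η
    swap
    · exact ⟨0, fun h => absurd h hη⟩
    obtain ⟨β, hβ, X₀, hBohr⟩ := exists_le_card_quadraticBohrSet (r * ⌈1 / η ^ 2⌉₊) hρ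
    -- A share 1/r of a set of density β has density β/r.
    obtain ⟨θ, hθ, c, hc, hcount⟩ := hcore (β / r) (by positivity)
    set η' := min (min (min η θ) (min c (β / 2))) (1 / (X₀ + 1)) with hη'
    have hη'0 : 0 < η' := by positivity
    have l1 : η' ≤ η := (min_le_left _ _).trans ((min_le_left _ _).trans (min_le_left _ _))
    have l2 : η' ≤ θ := (min_le_left _ _).trans ((min_le_left _ _).trans (min_le_right _ _))
    have l3 : η' ≤ c := (min_le_left _ _).trans ((min_le_right _ _).trans (min_le_left _ _))
    have l4 : η' ≤ β / 2 := (min_le_left _ _).trans ((min_le_right _ _).trans (min_le_right _ _))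
    have l5 : η' ≤ 1 / (X₀ + 1) := min_le_right _ _
    refine ⟨η', fun _ => ⟨hη'0, l1, ?_, ?_⟩⟩
    · refine l5.trans (div_le_one_of_le₀ ?_ (by positivity))
      have : (0 : ℝ) ≤ X₀ := Nat.cast_nonneg _
      linarith
    intro hηη₀ M hM Q hQ hQlow hQup κ u A hA hAcard hmid
    have hMX : (X₀ + 1 : ℝ) ≤ M := by
      refine le_trans ?_ hM
      rw [le_div_iff₀ hη'0, ← le_div_iff₀' (by positivity)]
      exact l5
    have hM1 : 1 ≤ M := by
      have : (0 : ℝ) ≤ X₀ := Nat.cast_nonneg _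
      linarith
    have hX₀ : X₀ ≤ ⌊M⌋₊ := Nat.le_floor (by linarith)
    have hX1 : 1 ≤ ⌊M⌋₊ := (Nat.one_le_floor_iff M).2 hM1
    have hM2X : M ≤ 2 * ⌊M⌋₊ := by
      have h1 := Nat.lt_floor_add_one M
      have h2 : (1 : ℝ) ≤ ⌊M⌋₊ := by exact_mod_cast hX1
      linarith
    have haQ : (a i₀ : ZMod Q) ≠ 0 := by
      refine intCast_zmod_ne_zero (ha i₀)
        ((natAbs_left_le_coefficientBound a b i₀).trans_lt ?_)
      have : (Λ : ℝ) < Q := lt_of_le_of_lt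
        (le_mul_of_one_le_right (Nat.cast_nonneg _) (one_le_pow₀ hM1)) hQlow
      exact_mod_cast this
    set Ω : Finset (ZMod Q) := κ.biUnion fun k => {ξ : ZMod Q |
      η * Q ≤ ‖indicatorDFT ((A k).image (Nat.cast : ℕ → ZMod Q)) (a i₀ * ξ)‖} with hΩ
    have hΩcard : #Ω ≤ r * ⌈1 / η ^ 2⌉₊ := by
      refine (card_biUnion_le_card_mul _ _ _ fun k _ => card_large_spectrum_le _ haQ hη).trans ?_
      gcongr
      simpa using card_le_univ κ
    have hB := hBohr Q Ω hΩcard ⌊M⌋₊ hX₀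
    refine ⟨quadraticBohrSet Q Ω ρ ⌊M⌋₊, filter_subset _ _, ?_, ?_⟩
    · refine le_trans ?_ hB
      calc η' * M ≤ β / 2 * (2 * ⌊M⌋₊) := by gcongr
        _ = _ := by ring
    · intro k hk D hD hDB
      refine le_trans (by gcongr) (hcount M hM1 Q hQlow hQup (u k) (A k) (hA k hk) (hAcard k hk)
        η η' hη'0.le l2 l1 hηη₀ (hmid k hk) D (hD.trans (filter_subset _ _)) ?_ ?_)
      · rw [div_mul_eq_mul_div, div_le_iff₀ hr0, mul_comm (#D : ℝ)]
        exact hB.trans (by exact_mod_cast hDB)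
      · intro y hy ξ hξ
        have := (mem_filter.1 (hD hy)).2
        exact this ξ (mem_biUnion.2 ⟨k, hk, mem_filter.2 ⟨mem_univ _, hξ⟩⟩)
  choose Φ hΦ using hstep
  set η : ℕ → ℝ := fun j => Φ^[j] η₀ with hηdef
  have hηsucc : ∀ j, η (j + 1) = Φ (η j) := fun j => Function.iterate_succ_apply' Φ j η₀
  have hηpos : ∀ j, 0 < η j := by
    intro j
    induction j with
    | zero => exact hη₀
    | succ j ih => rw [hηsucc]; exact (hΦ _ ih).1
  have hηle : ∀ j, η (j + 1) ≤ η j := fun j => by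
    rw [hηsucc]; exact (hΦ _ (hηpos j)).2.1
  have hanti : Antitone η := antitone_nat_of_succ_le hηle
  -- The energies of at most r sets total at most rQ², so one of J ≥ r/ε² levels carries at most
  -- (εQ)², for all the sets at once.
  set J := ⌈r / ε ^ 2⌉₊ with hJ
  have hJpos : 0 < J := Nat.ceil_pos.2 (by positivity)
  refine ⟨η J, hηpos J, ?_, ?_⟩
  · obtain ⟨j, hj⟩ := Nat.exists_eq_succ_of_ne_zero hJpos.ne'
    rw [hj, Nat.succ_eq_add_one, hηsucc]
    exact (hΦ _ (hηpos j)).2.2.1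
  intro M hM κ u A hA hAcard
  have hηJ1 : η J ≤ 1 := by
    obtain ⟨j, hj⟩ := Nat.exists_eq_succ_of_ne_zero hJpos.ne'
    rw [hj, Nat.succ_eq_add_one, hηsucc]
    exact (hΦ _ (hηpos j)).2.2.1
  have hM1 : 1 ≤ M := le_trans ((one_le_div (hηpos J)).2 hηJ1) hM
  have hM0 : 0 ≤ M := by linarith
  obtain ⟨Q, hQp, hQlow, hQup⟩ := exists_prime_between (Λ := Λ)
    (by rw [hΛ, coefficientBound]; omega) hM1
  have : Fact Q.Prime := ⟨hQp⟩
  have hQ0 : (0 : ℝ) < Q := by exact_mod_cast hQp.pos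
  have haQ : (a i₀ : ZMod Q) ≠ 0 := by
    refine intCast_zmod_ne_zero (ha i₀)
      ((natAbs_left_le_coefficientBound a b i₀).trans_lt ?_)
    have : (Λ : ℝ) < Q := lt_of_le_of_lt
      (le_mul_of_one_le_right (Nat.cast_nonneg _) (one_le_pow₀ hM1)) hQlow
    exact_mod_cast this
  set P : Fin r × ZMod Q → ℝ := fun p =>
    ‖indicatorDFT ((A p.1).image (Nat.cast : ℕ → ZMod Q)) (a i₀ * p.2)‖ with hP
  obtain ⟨j, hjJ, hj⟩ := exists_level_sum_sq_le (κ ×ˢ (univ : Finset (ZMod Q))) P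
    (η := fun j => η j * Q) (fun j => by have := hηle j; gcongr) hJpos
  have htotal : ∑ p ∈ κ ×ˢ (univ : Finset (ZMod Q)), P p ^ 2 ≤ r * (Q : ℝ) ^ 2 := by
    rw [sum_product]
    have hk : ∀ k ∈ κ, ∑ ξ : ZMod Q, P (k, ξ) ^ 2 ≤ (Q : ℝ) ^ 2 := fun k _ =>
      sum_norm_sq_indicatorDFT_le ((A k).image (Nat.cast : ℕ → ZMod Q)) haQ
    refine (sum_le_sum hk).trans ?_
    rw [sum_const, nsmul_eq_mul]
    gcongr
    simpa using card_le_univ κ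
  have hmid : ∑ p ∈ κ ×ˢ (univ : Finset (ZMod Q)) with η (j + 1) * Q ≤ P p ∧ P p < η j * Q,
      P p ^ 2 ≤ (ε * Q) ^ 2 := by
    have hJle : r / ε ^ 2 ≤ J := Nat.le_ceil _
    have hJ0 : (0 : ℝ) < J := by exact_mod_cast hJpos
    refine le_of_mul_le_mul_left ((hj.trans htotal).trans ?_) hJ0
    rw [div_le_iff₀ (by positivity)] at hJle
    calc r * (Q : ℝ) ^ 2 ≤ (J * ε ^ 2) * Q ^ 2 := by gcongr
      _ = _ := by ring
  have hmid' : ∀ k ∈ κ, ∑ ξ : ZMod Q with η (j + 1) * Q ≤ P (k, ξ) ∧ P (k, ξ) < η j * Q,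
      P (k, ξ) ^ 2 ≤ (ε * Q) ^ 2 := by
    intro k hk
    refine le_trans ?_ hmid
    rw [sum_filter, sum_filter, sum_product]
    exact single_le_sum (f := fun k => ∑ ξ : ZMod Q,
      if η (j + 1) * Q ≤ P (k, ξ) ∧ P (k, ξ) < η j * Q then P (k, ξ) ^ 2 else 0)
      (fun k _ => sum_nonneg fun ξ _ => by split_ifs <;> positivity) hk
  have hJj : η J ≤ η (j + 1) := hanti hjJ
  have hMj : 1 / η (j + 1) ≤ M := le_trans (one_div_le_one_div_of_le (hηpos J) hJj) hM
  have hη₀j : η j ≤ η₀ := hanti (Nat.zero_le j)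
  rw [hηsucc] at hMj hmid' hJj
  obtain ⟨B, hBsub, hBcard, hB⟩ := (hΦ (η j) (hηpos j)).2.2.2 hη₀j M hMj Q hQlow hQup κ u A hA
    hAcard hmid'
  refine ⟨B, hBsub, le_trans (by gcongr) hBcard, fun k hk D hD hDB => ?_⟩
  exact le_trans (by gcongr) (hB k hk D hD hDB)

/-! ### Descent through the scales -/

theorem solutionCount_mono {s t : ℕ} (a : Fin s → ℤ) (b : Fin t → ℤ) {X X' : Fin s → Finset ℕ}
    {Y Y' : Fin t → Finset ℕ} (hX : ∀ i, X i ⊆ X' i) (hY : ∀ j, Y j ⊆ Y' j) :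
    solutionCount a b X Y ≤ solutionCount a b X' Y' :=
  Finset.card_le_card (Finset.filter_subset_filter _
    (Finset.product_subset_product (Fintype.piFinset_subset _ _ hX)
      (Fintype.piFinset_subset _ _ hY)))

theorem mem_restrictToInterval {A : Finset ℕ} {u x : ℕ} {L : ℝ} :
    x ∈ restrictToInterval A u L ↔ x ∈ A ∧ (u : ℝ) < x ∧ (x : ℝ) ≤ u + L := by
  simp [restrictToInterval]

open Finset in
/-- A set that is dense in an interval of length `M ^ 2` is dense in a subinterval of
length `M`. -/
theorem exists_dense_restrictToInterval {A : Finset ℕ} {u : ℕ} {M δ : ℝ} (hM : 1 ≤ M) (hδ : 0 ≤ δ)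
    (h : δ * M ^ 2 ≤ #(restrictToInterval A u (M ^ 2))) :
    ∃ v : ℕ, δ / 4 * M ≤ #(restrictToInterval A v M) := by
  set m := ⌊M⌋₊ with hm
  have hm1 : 1 ≤ m := (Nat.one_le_floor_iff M).2 hM
  have hm1' : (1 : ℝ) ≤ m := by exact_mod_cast hm1
  have hmM : (m : ℝ) ≤ M := Nat.floor_le (by linarith)
  have hM2m : M ≤ 2 * m := by have := Nat.lt_floor_add_one M; rw [← hm] at this; linarith
  -- Blocks (u + jm, u + (j + 1)m] of integer length m = ⌊M⌋ keep the left endpoints integral. At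
  -- most 4M of them are needed, whence the loss of a factor 4.
  set J := ⌊M ^ 2⌋₊ / m + 1 with hJ
  have hmaps : ∀ x ∈ restrictToInterval A u (M ^ 2), (x - u - 1) / m ∈ range J := by
    intro x hx
    obtain ⟨-, h1, h2⟩ := mem_restrictToInterval.1 hx
    have h1' : u < x := by exact_mod_cast h1
    have h3 : x - u ≤ ⌊M ^ 2⌋₊ := by
      refine Nat.le_floor ?_
      rw [Nat.cast_sub h1'.le]
      linarith
    rw [mem_range, hJ, Nat.lt_succ_iff]
    exact Nat.div_le_div_right (by omega)
  have hJle : (J : ℝ) ≤ 4 * M := by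
    have h1 : ((⌊M ^ 2⌋₊ / m : ℕ) : ℝ) ≤ 2 * M := by
      refine Nat.cast_div_le.trans ?_
      rw [div_le_iff₀ (by linarith)]
      refine (Nat.floor_le (by positivity)).trans ?_
      nlinarith
    rw [hJ]
    push_cast at h1 ⊢
    linarith
  obtain ⟨j, -, hj⟩ := exists_le_card_fiber_of_nsmul_le_card_of_maps_to (b := δ / 4 * M) hmaps
    (nonempty_range_iff.2 (Nat.succ_ne_zero _)) (by
      rw [card_range, nsmul_eq_mul]
      refine le_trans ?_ h
      calc (J : ℝ) * (δ / 4 * M) ≤ 4 * M * (δ / 4 * M) := by gcongr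
        _ = _ := by ring)
  refine ⟨u + j * m, hj.trans ?_⟩
  norm_cast
  refine card_le_card fun x hx => ?_
  obtain ⟨hx, hxj⟩ := mem_filter.1 hx
  obtain ⟨hA, h1, -⟩ := mem_restrictToInterval.1 hx
  have h1' : u < x := by exact_mod_cast h1
  have h2 := Nat.div_mul_le_self (x - u - 1) m
  have h3 := Nat.lt_div_mul_add (a := x - u - 1) (show 0 < m by omega)
  rw [hxj] at h2 h3
  rw [mem_restrictToInterval]
  have h4 : u + j * m < x := by omega
  have h5 : x ≤ u + j * m + m := by omega
  have h5' : (x : ℝ) ≤ (u + j * m : ℕ) + m := by exact_mod_cast h5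
  exact ⟨hA, by exact_mod_cast h4, by linarith⟩

open Finset in
/-- Some colour class contains at least its share of a given set. -/
theorem exists_colour_card_le {r N : ℕ} {C : Fin r → Finset ℕ} (hC : IsColouring N C)
    (hr : 1 ≤ r) {B : Finset ℕ} (hB : B ⊆ Icc 1 N) : ∃ k, #B ≤ r * #(B ∩ C k) := by
  have : Nonempty (Fin r) := ⟨⟨0, hr⟩⟩
  obtain ⟨k, -, hk⟩ := exists_max_image (univ : Finset (Fin r)) (fun k => #(B ∩ C k)) univ_nonempty
  refine ⟨k, ?_⟩
  calc #B ≤ #((univ : Finset (Fin r)).biUnion fun k => B ∩ C k) := by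
        refine card_le_card fun x hx => ?_
        have := hB hx
        rw [← hC, mem_biUnion] at this
        obtain ⟨l, hl, hxl⟩ := this
        exact mem_biUnion.2 ⟨l, hl, mem_inter.2 ⟨hx, hxl⟩⟩
    _ ≤ #(univ : Finset (Fin r)) * #(B ∩ C k) := card_biUnion_le_card_mul _ _ _ hk
    _ = r * #(B ∩ C k) := by simp

theorem rpow_one_div_two_pow_succ_sq (N n : ℕ) :
    ((N : ℝ) ^ ((1 : ℝ) / 2 ^ (n + 1))) ^ 2 = (N : ℝ) ^ ((1 : ℝ) / 2 ^ n) := by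
  rw [← Real.rpow_natCast, ← Real.rpow_mul (Nat.cast_nonneg _)]
  congr 1
  rw [pow_succ]
  push_cast
  field_simp

theorem lt_rpow_one_div_two_pow {N : ℕ} (n : ℕ) {K : ℝ} (h : K ^ 2 ^ n < N) :
    K < (N : ℝ) ^ ((1 : ℝ) / 2 ^ n) := by
  have h1 : ((N : ℝ) ^ ((1 : ℝ) / 2 ^ n)) ^ 2 ^ n = N := by
    rw [← Real.rpow_natCast, ← Real.rpow_mul (Nat.cast_nonneg _)]
    push_cast
    rw [one_div_mul_cancel (by positivity), Real.rpow_one]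
  refine lt_of_pow_lt_pow_left₀ (2 ^ n) (by positivity) ?_
  rwa [h1]

/-- There are at least `c M ^ (|S| + s + t - 2)` monochromatic solutions localised at
scale `n`, where `M = N ^ (1 / 2 ^ n)`. -/
def HasLocalisedSolutions {s t r : ℕ} (a : Fin s → ℤ) (b : Fin t → ℤ) (S : Finset (Fin s))
    (C : Fin r → Finset ℕ) (N : ℕ) (c : ℝ) (n : ℕ) : Prop :=
  ∃ k : Fin r, ∃ u : ℕ,
    c * ((N : ℝ) ^ ((1 : ℝ) / 2 ^ n)) ^ (S.card + s + t - 2) ≤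
      (solutionCount a b
        (fun i => if i ∈ S
          then restrictToInterval (C k) u ((N : ℝ) ^ ((1 : ℝ) / 2 ^ (n - 1)))
          else C k ∩ initialInterval ((N : ℝ) ^ ((1 : ℝ) / 2 ^ n)))
        (fun _ => C k ∩ initialInterval ((N : ℝ) ^ ((1 : ℝ) / 2 ^ n))) : ℝ)

theorem HasLocalisedSolutions.mono {s t r : ℕ} {a : Fin s → ℤ} {b : Fin t → ℤ}
    {S : Finset (Fin s)} {C : Fin r → Finset ℕ} {N : ℕ} {c c' : ℝ} {n : ℕ}
    (h : HasLocalisedSolutions a b S C N c n) (hc : c' ≤ c) :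
    HasLocalisedSolutions a b S C N c' n := by
  obtain ⟨k, u, h⟩ := h
  exact ⟨k, u, le_trans (by gcongr) h⟩

open Finset in
theorem exists_localised_or_dense_colours {s t : ℕ} (ht : 1 ≤ t) (a : Fin s → ℤ) (b : Fin t → ℤ)
    (ha : ∀ i, a i ≠ 0) (hb : ∀ j, b j ≠ 0) (S : Finset (Fin s)) (hSc : 2 ≤ #S)
    (hS : ∑ i ∈ S, a i = 0) {r : ℕ} (hr : 1 ≤ r) (n : ℕ) :
    ∃ c : ℝ, 0 < c ∧ ∃ δ : ℝ, 0 < δ ∧ ∃ K : ℝ, ∀ N : ℕ, 1 ≤ N → K < N →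
      ∀ C : Fin r → Finset ℕ, IsColouring N C →
      (∃ n', 1 ≤ n' ∧ n' ≤ n ∧ HasLocalisedSolutions a b S C N c n') ∨
      ∃ κ : Finset (Fin r), #κ = n + 1 ∧ ∃ u : Fin r → ℕ, ∀ k ∈ κ,
        δ * (N : ℝ) ^ ((1 : ℝ) / 2 ^ n) ≤
          #(restrictToInterval (C k) (u k) ((N : ℝ) ^ ((1 : ℝ) / 2 ^ n))) := by
  have hr0 : (0 : ℝ) < r := by exact_mod_cast hr
  induction n with
  | zero =>
    refine ⟨1, one_pos, 1 / r, by positivity, 0, fun N hN _ C hC => Or.inr ?_⟩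
    obtain ⟨k, hk⟩ := exists_colour_card_le hC hr (Subset.refl _)
    refine ⟨{k}, by simp, fun _ => 0, fun k' hk' => ?_⟩
    rw [mem_singleton] at hk'
    subst hk'
    rw [Nat.card_Icc, Nat.add_sub_cancel] at hk
    have hsub : Icc 1 N ∩ C k' ⊆ restrictToInterval (C k') 0 ((N : ℝ) ^ ((1 : ℝ) / 2 ^ 0)) := by
      intro x hx
      rw [mem_inter, mem_Icc] at hx
      rw [mem_restrictToInterval]
      refine ⟨hx.2, by exact_mod_cast hx.1.1, ?_⟩
      simpa using hx.1.2
    have h1 : (N : ℝ) ≤ r * #(restrictToInterval (C k') 0 ((N : ℝ) ^ ((1 : ℝ) / 2 ^ 0))) := by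
      exact_mod_cast hk.trans (Nat.mul_le_mul_left _ (card_le_card hsub))
    rw [one_div_mul_eq_div, div_le_iff₀' hr0]
    simpa using h1
  | succ n ih =>
    obtain ⟨c, hc, δ, hδ, K, ih⟩ := ih
    obtain ⟨c', hc', hc'1, hcore⟩ := exists_common_bohr_set ht a b ha hb S hSc hS hr hδ
    refine ⟨min c c', by positivity, min (δ / 4) (c' / r), by positivity,
      max K ((1 / c') ^ 2 ^ (n + 1)), fun N hN hKN C hC => ?_⟩
    rcases ih N hN ((le_max_left _ _).trans_lt hKN) C hC with ⟨n', h1, h2, h3⟩ | ⟨κ, hκ, u, hu⟩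
    · exact Or.inl ⟨n', h1, h2.trans (Nat.le_succ n), h3.mono (min_le_left _ _)⟩
    set M : ℝ := (N : ℝ) ^ ((1 : ℝ) / 2 ^ (n + 1)) with hM
    have hMsq : (N : ℝ) ^ ((1 : ℝ) / 2 ^ n) = M ^ 2 := (rpow_one_div_two_pow_succ_sq N n).symm
    have hcM : 1 / c' < M :=
      lt_rpow_one_div_two_pow _ ((le_max_right _ _).trans_lt hKN)
    have hM1 : 1 ≤ M := ((one_le_div hc').2 hc'1).trans hcM.le
    have hMN : M ≤ N := by
      have h1 : (1 : ℝ) ≤ N := by exact_mod_cast hN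
      calc M ≤ (N : ℝ) ^ (1 : ℝ) := by
            refine Real.rpow_le_rpow_of_exponent_le h1 ?_
            exact div_le_one_of_le₀ (one_le_pow₀ one_le_two) (by positivity)
        _ = N := Real.rpow_one _
    rw [hMsq] at hu
    obtain ⟨B, hBsub, hBcard, hB⟩ := hcore M hcM.le κ u
      (fun k => restrictToInterval (C k) (u k) (M ^ 2))
      (fun k _ x hx => (mem_restrictToInterval.1 hx).2) hu
    obtain ⟨l, hl⟩ := exists_colour_card_le hC hr (B := B)
      (hBsub.trans (Icc_subset_Icc_right (Nat.floor_le_of_le hMN)))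
    -- A class already in κ supplies both the dense set and D, hence monochromatic solutions. Any
    -- other class is added to κ.
    by_cases hlκ : l ∈ κ
    · refine Or.inl ⟨n + 1, by omega, le_rfl, l, u l, ?_⟩
      have hD : B ∩ C l ⊆ C l ∩ initialInterval M := fun x hx => by
        rw [mem_inter] at hx
        exact mem_inter.2 ⟨hx.2, hBsub hx.1⟩
      have hcount := hB l hlκ (B ∩ C l) inter_subset_left hl
      rw [Nat.add_sub_cancel, hMsq, ← hM]
      calc min c c' * M ^ (#S + s + t - 2) ≤ c' * M ^ (#S + s + t - 2) := by
            gcongr; exact min_le_right _ _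
        _ ≤ _ := hcount
        _ ≤ _ := by
            refine Nat.cast_le.2 (solutionCount_mono a b (fun i => ?_) fun _ => hD)
            split_ifs
            · exact Subset.refl _
            · exact hD
    · right
      have hold : ∀ k : Fin r, ∃ v : ℕ, k ∈ κ → δ / 4 * M ≤ #(restrictToInterval (C k) v M) := by
        intro k
        by_cases hk : k ∈ κ
        · obtain ⟨v, hv⟩ := exists_dense_restrictToInterval hM1 hδ.le (hu k hk)
          exact ⟨v, fun _ => hv⟩
        · exact ⟨0, fun h => absurd h hk⟩
      choose v hv using hold
      -- The new class is dense in [M], so its interval starts at 0.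
      refine ⟨insert l κ, by rw [card_insert_of_notMem hlκ, hκ],
        fun k => if k = l then 0 else v k, fun k hk => ?_⟩
      by_cases hkl : k = l
      · subst hkl
        simp only [if_true]
        have hsub : B ∩ C k ⊆ restrictToInterval (C k) 0 M := by
          intro x hx
          rw [mem_inter] at hx
          have hx' := mem_Icc.1 (hBsub hx.1)
          rw [mem_restrictToInterval]
          refine ⟨hx.2, by exact_mod_cast hx'.1, ?_⟩
          rw [Nat.cast_zero, zero_add]
          exact (Nat.le_floor_iff (by linarith)).1 hx'.2
        have h1 : (#B : ℝ) ≤ r * #(restrictToInterval (C k) 0 M) := by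
          exact_mod_cast hl.trans (Nat.mul_le_mul_left _ (card_le_card hsub))
        calc min (δ / 4) (c' / r) * M ≤ c' / r * M := by gcongr; exact min_le_right _ _
          _ ≤ _ := by
              rw [div_mul_eq_mul_div, div_le_iff₀' hr0]
              exact hBcard.trans h1
      · simp only [if_neg hkl]
        refine le_trans ?_ (hv k ((mem_insert.1 hk).resolve_left hkl))
        gcongr
        exact min_le_left _ _

/-! ### Uniformity in the index set and conclusion -/

open Finset in
theorem two_le_card_of_sum_eq_zero {s : ℕ} {a : Fin s → ℤ} (ha : ∀ i, a i ≠ 0)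
    {S : Finset (Fin s)} (hS : S.Nonempty) (hsum : ∑ i ∈ S, a i = 0) : 2 ≤ #S := by
  by_contra! h
  obtain ⟨i, rfl⟩ := card_eq_one.1 (le_antisymm (by omega) hS.card_pos)
  exact ha i (by simpa using hsum)

open Finset in
theorem exists_localised_solutions {s t : ℕ} (ht : 1 ≤ t) (a : Fin s → ℤ) (b : Fin t → ℤ)
    (ha : ∀ i, a i ≠ 0) (hb : ∀ j, b j ≠ 0) {r : ℕ} (hr : 1 ≤ r) :
    ∃ c : ℝ, 0 < c ∧ ∃ K : ℝ, ∀ S : Finset (Fin s), S.Nonempty → ∑ i ∈ S, a i = 0 →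
      ∀ N : ℕ, 1 ≤ N → K < N → ∀ C : Fin r → Finset ℕ, IsColouring N C →
      ∃ n, 1 ≤ n ∧ n ≤ r ∧ HasLocalisedSolutions a b S C N c n := by
  have key : ∀ S : Finset (Fin s), ∃ c : ℝ, 0 < c ∧ ∃ K : ℝ, S.Nonempty → ∑ i ∈ S, a i = 0 →
      ∀ N : ℕ, 1 ≤ N → K < N → ∀ C : Fin r → Finset ℕ, IsColouring N C →
      ∃ n, 1 ≤ n ∧ n ≤ r ∧ HasLocalisedSolutions a b S C N c n := by
    intro S
    by_cases hS : S.Nonempty ∧ ∑ i ∈ S, a i = 0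
    swap
    · exact ⟨1, one_pos, 0, fun h1 h2 => absurd ⟨h1, h2⟩ hS⟩
    obtain ⟨c, hc, _, _, K, h⟩ := exists_localised_or_dense_colours ht a b ha hb S
      (two_le_card_of_sum_eq_zero ha hS.1 hS.2) hS.2 hr r
    refine ⟨c, hc, K, fun _ _ N hN hKN C hC => ?_⟩
    -- Taking n = r, the alternative would need r + 1 distinct classes.
    rcases h N hN hKN C hC with h | ⟨κ, hκ, -⟩
    · exact h
    · have := card_le_univ κ
      rw [Fintype.card_fin] at this
      omega
  choose c hc K h using key
  refine ⟨univ.inf' univ_nonempty c, (lt_inf'_iff _).2 fun S _ => hc S,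
    univ.sup' univ_nonempty K, fun S hS hsum N hN hKN C hC => ?_⟩
  obtain ⟨n, h1, h2, h3⟩ := h S hS hsum N hN ((le_sup' K (mem_univ S)).trans_lt hKN) C hC
  exact ⟨n, h1, h2, h3.mono (inf'_le c (mem_univ S))⟩

theorem mainTheorem4 (s t : ℕ) (ht : 1 ≤ t)
    (a : Fin s → ℤ) (b : Fin t → ℤ) (ha : ∀ i, a i ≠ 0) (hb : ∀ j, b j ≠ 0)
    (r : ℕ) (hr : 1 ≤ r) :
    -- counting monochromatic solutions
    (∃ c : ℝ, 0 < c ∧ ∃ ε : ℕ → ℝ, Tendsto ε atTop (𝓝 0) ∧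
      ∀ I : Finset (Fin s), I.Nonempty → ∑ i ∈ I, a i = 0 →
      ∀ N : ℕ, 1 ≤ N → ∀ C : Fin r → Finset ℕ, IsColouring N C →
      ∃ k : Fin r,
        c * (N : ℝ) ^ (((I.card : ℝ) + s + t - 2) / 2 ^ r) * (1 - ε N) ≤
          (solutionCount a b (fun _ => C k) (fun _ => C k) : ℝ)) ∧
    -- localised count, at a scale `n`, with `M = N ^ (1 / 2 ^ n)`
    (∃ c : ℝ, 0 < c ∧ ∃ K : ℝ,
      ∀ S : Finset (Fin s), S.Nonempty → ∑ i ∈ S, a i = 0 →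
      ∀ N : ℕ, 1 ≤ N → (N : ℝ) ≤ K ∨
      ∀ C : Fin r → Finset ℕ, IsColouring N C →
      ∃ n : ℕ, 1 ≤ n ∧ n ≤ r ∧ ∃ k : Fin r, ∃ u : ℕ, ∃ M : ℝ,
        M = (N : ℝ) ^ ((1 : ℝ) / 2 ^ n) ∧
        c * M ^ ((S.card : ℝ) + s + t - 2) ≤
          (solutionCount a b
            (fun i => if i ∈ S
              then restrictToInterval (C k) u ((N : ℝ) ^ ((1 : ℝ) / 2 ^ (n - 1)))
              else C k ∩ initialInterval M)
            (fun _ => C k ∩ initialInterval M) : ℝ)) := by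
  obtain ⟨c, hc, K, h⟩ := exists_localised_solutions ht a b ha hb hr
  have hexp : ∀ S : Finset (Fin s), S.Nonempty → ∑ i ∈ S, a i = 0 →
      ((S.card : ℝ) + s + t - 2) = ((S.card + s + t - 2 : ℕ) : ℝ) := by
    intro S hS hsum
    have := two_le_card_of_sum_eq_zero ha hS hsum
    rw [Nat.cast_sub (by omega)]
    push_cast
    ring
  constructor
  -- The value ε = 1 up to K makes the bound there trivial. Beyond K there is no loss, since
  -- N^(1/2^n) ≥ N^(1/2^r) for n ≤ r.
  · refine ⟨c, hc, fun N => if (N : ℝ) ≤ K then 1 else 0, ?_, ?_⟩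
    · refine tendsto_const_nhds.congr' ?_
      filter_upwards [eventually_gt_atTop ⌈K⌉₊] with N hN
      rw [if_neg (not_le.2 (Nat.lt_of_ceil_lt hN))]
    · intro I hI hsum N hN C hC
      by_cases hNK : (N : ℝ) ≤ K
      · refine ⟨⟨0, hr⟩, ?_⟩
        simp only [if_pos hNK, sub_self, mul_zero]
        exact Nat.cast_nonneg _
      · obtain ⟨n, hn1, hnr, k, u, hk⟩ := h I hI hsum N hN (not_le.1 hNK) C hC
        refine ⟨k, ?_⟩
        simp only [if_neg hNK, sub_zero, mul_one, hexp I hI hsum]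
        have hN' : (1 : ℝ) ≤ N := by exact_mod_cast hN
        refine le_trans ?_ (hk.trans (Nat.cast_le.2 (solutionCount_mono a b (fun i => ?_)
          fun _ => Finset.inter_subset_left)))
        · gcongr
          rw [← Real.rpow_natCast ((N : ℝ) ^ ((1 : ℝ) / 2 ^ n)),
            ← Real.rpow_mul (Nat.cast_nonneg _), one_div_mul_eq_div]
          refine Real.rpow_le_rpow_of_exponent_le hN' ?_
          gcongr
          exact one_le_two
        · split_ifs
          · exact Finset.filter_subset _ _
          · exact Finset.inter_subset_left
  · refine ⟨c, hc, K, fun S hS hsum N hN => ?_⟩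
    by_cases hNK : (N : ℝ) ≤ K
    · exact Or.inl hNK
    refine Or.inr fun C hC => ?_
    obtain ⟨n, hn1, hnr, k, u, hk⟩ := h S hS hsum N hN (not_le.1 hNK) C hC
    refine ⟨n, hn1, hnr, k, u, _, rfl, ?_⟩
    rw [hexp S hS hsum, Real.rpow_natCast]
    exact hk
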